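/- **Setting.** Let $F$ be a finite set of fluents. A state is a subset of $F$. An action is a triple $a=\langle \mathrm{pre}(a),\mathrm{add}(a),\mathrm{del}(a)\rangle$ of subsets of $F$, and a domain $D=\langle F,A\rangle$ has a finite set $A$ of actions. For $a\in A$, $T(a,s,D)=(s\setminus \mathrm{del}(a))\cup \mathrm{add}(a)$ if $\mathrm{pre}(a)\subseteq s$, and it is undefined otherwise; $T$ extends to finite action sequences $\pi$ by executing the actions of $\pi$ one after the other. A sequence $\pi$ *achieves* $G\subseteq F$ from $I$ in $D$ if $T(\pi,I,D)$ is defined and $T(\pi,I,D)\supseteq G$. A *human-aware goal alignment (HAGL) problem* is a tuple $\mathcal P=\langle D^R,I^R,G^H,D^H,I^H,\pi^H,\mathcal O\rangle$ of a robot domain $D^R=\langle F,A^R\rangle$, an initial state $I^R\subseteq F$, a goal specification $G^H\subseteq F$, a human domain $D^H=\langle F,A^H\rangle$, an initial state $I^H\subseteq F$, a human plan $\pi^H$ and an oracle $\mathcal O:F\to\{0,1\}$, such that for some (hidden) goal $G^*\subseteq F$ we have $T(\pi^H,I^H,D^H)\supseteq G^*$, $G^H\subseteq G^*$, and $\mathcal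 O(f)=1$ if and only if $f\in G^*$, for all $f \in F$. A *querying procedure* is a finite decision tree. Each inner node queries the oracle about one fluent and branches on the answer; each leaf returns an action sequence or the answer "no plan". It *solves* $\mathcal P$ if for every goal $G$ with $G^H\subseteq G\subseteq T(\pi^H,I^H,D^H)$, when its queries are answered according to membership in $G$, it returns a sequence that achieves $G$ from $I^R$ in $D^R$ if there is one, and "no plan" otherwise. **The decision version of HAGL.** Given a HAGL problem $\mathcal P$ (all components listed explicitly, $\mathcal O$ as a table) and $K\in\mathbb N$ in binary, is there a querying procedure that solves $\mathcal P$ and that, run with the oracle $\mathcal O$, returns a plan (which then achieves $G^*$) after at most $K$ queries? **Proposition.** The decision version of HAGL is PSPACE-hard: every language in PSPACE is reducible to it by a polynomial-time many-one reduction. -/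

import Mathlib

/-! ## Deterministic goal-directed planning -/

/-- An action over a set `F` of fluents: preconditions, add effects and delete effects. -/
structure PlanAction (F : Type) where
  pre : Finset F
  add : Finset F
  del : Finset F
deriving DecidableEq

/-- A domain model `D = ⟨F, A⟩`. The fluents are the elements of `F`; the finite set `A` of
actions is given by listing its elements. -/
structure PlanDomain (F : Type) where
  actions : List (PlanAction F)

namespace PlanDomain

variable {F : Type} [DecidableEq F]

/-- The result of executing one action of the domain in a state (a state is the set of fluents
that are true in it); `none` means "undefined". -/
def trans (D : PlanDomain F) (a : PlanAction F) (s : Finset F) : Option (Finset F) :=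
  if a ∈ D.actions ∧ a.pre ⊆ s then some ((s \ a.del) ∪ a.add) else none

/-- The result of executing a sequence of actions, the head of the list first. -/
def exec (D : PlanDomain F) : List (PlanAction F) → Finset F → Option (Finset F)
  | [], s => some s
  | a :: π, s => (D.trans a s).bind (exec D π)

/-- `π` is a plan for `⟨D, I, G⟩`: executing `π` in `I` is defined and ends in a state that
contains `G`. -/
def Achieves (D : PlanDomain F) (I : Finset F) (π : List (PlanAction F)) (G : Finset F) : Prop :=
  ∃ s, D.exec π I = some s ∧ G ⊆ s

end PlanDomain

/-! ## Human-aware goal alignment -/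

/-- A human-aware goal alignment problem `⟨D^R, I^R, G^H, D^H, I^H, π^H, O⟩`, where for some goal
`G*` the human plan achieves `G*` in the human model, `G^H ⊆ G*`, and `O f = 1` iff `f ∈ G*`. -/
structure HAGL (F : Type) [DecidableEq F] where
  robotDomain : PlanDomain F
  robotInit : Finset F
  humanGoal : Finset F
  humanDomain : PlanDomain F
  humanInit : Finset F
  humanPlan : List (PlanAction F)
  oracle : F → Bool
  exists_goal : ∃ Gstar : Finset F,
    humanDomain.Achieves humanInit humanPlan Gstar ∧ humanGoal ⊆ Gstar ∧
      ∀ f, oracle f = true ↔ f ∈ Gstar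

/-- A deterministic adaptive querying procedure of the robot. It either stops, returning a plan or
the answer that there is none, or asks whether the fluent `f` belongs to the hidden goal, and
continues according to the answer. -/
inductive QueryProcedure (F : Type) where
  | finish (result : Option (List (PlanAction F)))
  | ask (f : F) (ifNo ifYes : QueryProcedure F)

namespace QueryProcedure

variable {F : Type}

/-- What the procedure returns when its queries are answered by the oracle `O`. -/
def run : QueryProcedure F → (F → Bool) → Option (List (PlanAction F))
  | finish r, _ => r
  | ask f no yes, O => if O f = true then yes.run O else no.run O

/-- The number of queries the procedure makes to the oracle `O` before it stops. -/
def numQueries : QueryProcedure F → (F → Bool) → ℕ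
  | finish _, _ => 0
  | ask f no yes, O => (if O f = true then yes.numQueries O else no.numQueries O) + 1

end QueryProcedure

namespace HAGL

variable {F : Type} [DecidableEq F]

/-- The goals that the robot cannot exclude before it has asked anything. -/
def Compatible (P : HAGL F) (G : Finset F) : Prop :=
  P.humanDomain.Achieves P.humanInit P.humanPlan G ∧ P.humanGoal ⊆ G

/-- A procedure solves the problem if, whichever of the compatible goals is the hidden one, it
returns a robot plan that achieves the hidden goal if there is one, and otherwise the answer that
there is none. (So the procedure may depend on everything in `P` except the oracle.) -/
def SolvedBy (P : HAGL F) (σ : QueryProcedure F) : Prop :=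
  ∀ G : Finset F, P.Compatible G →
    match σ.run (fun f => decide (f ∈ G)) with
    | some π => P.robotDomain.Achieves P.robotInit π G
    | none => ¬ ∃ π, P.robotDomain.Achieves P.robotInit π G

/-- A plan that achieves the hidden goal can be found with at most `K` queries to the oracle:
some procedure that solves the problem returns a plan after at most `K` queries when it is run
with the oracle of the problem. -/
def PlanWithQueries (P : HAGL F) (K : ℕ) : Prop :=
  ∃ σ : QueryProcedure F, P.SolvedBy σ ∧
    (∃ π, σ.run P.oracle = some π) ∧ σ.numQueries P.oracle ≤ K

end HAGL

/-! ## The decision version and its instances as strings -/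

/-- An instance of the decision version: a problem over the fluents `0, …, numFluents - 1` and a
bound on the number of queries. -/
structure HAGLInstance where
  numFluents : ℕ
  problem : HAGL (Fin numFluents)
  bound : ℕ

namespace HAGLInstance

open Computability

/-- The yes-instances of the decision version. -/
def IsYes (x : HAGLInstance) : Prop := x.problem.PlanWithQueries x.bound

/-- A set of fluents, written as its characteristic bit vector. -/
def encodeSet {n : ℕ} (s : Finset (Fin n)) : List Γ' :=
  (List.ofFn fun i : Fin n => decide (i ∈ s)).map Γ'.bit

/-- An action `⟨pre, add, del⟩`, written as `(pre,add,del)`. -/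
def encodeAction {n : ℕ} (a : PlanAction (Fin n)) : List Γ' :=
  [Γ'.bra] ++ encodeSet a.pre ++ [Γ'.comma] ++ encodeSet a.add ++ [Γ'.comma] ++
    encodeSet a.del ++ [Γ'.ket]

/-- A list of actions, written one after the other. -/
def encodeActions {n : ℕ} (l : List (PlanAction (Fin n))) : List Γ' := l.flatMap encodeAction

/-- An instance, written as a string: the four sets (the oracle being given by the set of fluents
to which it answers yes), the actions of both domains, the human plan, and the bound in binary,
separated by commas. -/
def encode (x : HAGLInstance) : List Γ' :=
  encodeSet x.problem.robotInit ++ [Γ'.comma] ++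
  encodeSet x.problem.humanInit ++ [Γ'.comma] ++
  encodeSet x.problem.humanGoal ++ [Γ'.comma] ++
  encodeSet (Finset.univ.filter fun f => x.problem.oracle f = true) ++ [Γ'.comma] ++
  encodeActions x.problem.robotDomain.actions ++ [Γ'.comma] ++
  encodeActions x.problem.humanDomain.actions ++ [Γ'.comma] ++
  encodeActions x.problem.humanPlan ++ [Γ'.comma] ++
  (encodeNat x.bound).map Γ'.bit

theorem length_encodeSet {n : ℕ} (s : Finset (Fin n)) : (encodeSet s).length = n := by
  simp [encodeSet]

theorem encodeSet_injective {n : ℕ} : Function.Injective (encodeSet (n := n)) := by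
  intro s t h
  have hb : Function.Injective Γ'.bit := fun a b h => by injection h
  have h2 := List.ofFn_injective (hb.list_map h)
  ext i
  simpa using congrFun h2 i

/-- Different comma-terminated bit blocks cannot be prefixes of the same string. -/
theorem bits_comma_inj {u v : List Bool} {r r' : List Γ'}
    (h : u.map Γ'.bit ++ Γ'.comma :: r = v.map Γ'.bit ++ Γ'.comma :: r') :
    u = v ∧ r = r' := by
  induction u generalizing v with
  | nil => cases v <;> simp_all
  | cons a u ih =>
    cases v with
    | nil => simp at h
    | cons b v =>
      simp only [List.map_cons, List.cons_append, List.cons.injEq, Γ'.bit.injEq] at h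
      obtain ⟨rfl, h⟩ := h
      obtain ⟨rfl, h2⟩ := ih h
      exact ⟨rfl, h2⟩

theorem encodeSet_append_inj {n : ℕ} {s t : Finset (Fin n)} {r r' : List Γ'}
    (h : encodeSet s ++ r = encodeSet t ++ r') : s = t ∧ r = r' := by
  obtain ⟨h1, h2⟩ := List.append_inj h (by simp [length_encodeSet])
  exact ⟨encodeSet_injective h1, h2⟩

theorem encodeActions_comma_inj {n : ℕ} {l m : List (PlanAction (Fin n))} {r r' : List Γ'}
    (h : encodeActions l ++ Γ'.comma :: r = encodeActions m ++ Γ'.comma :: r') :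
    l = m ∧ r = r' := by
  induction l generalizing m with
  | nil => cases m <;> simp_all [encodeActions, encodeAction]
  | cons a l ih =>
    cases m with
    | nil => simp [encodeActions, encodeAction] at h
    | cons b m =>
      simp only [encodeActions, List.flatMap_cons, encodeAction, List.append_assoc,
        List.cons_append, List.nil_append, List.cons.injEq, true_and] at h
      obtain ⟨h1, h⟩ := encodeSet_append_inj h
      obtain ⟨h2, h⟩ := encodeSet_append_inj (List.cons.inj h).2
      obtain ⟨h3, h⟩ := encodeSet_append_inj (List.cons.inj h).2
      obtain ⟨rfl, h4⟩ := ih (m := m) (List.cons.inj h).2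
      refine ⟨?_, h4⟩
      cases a
      cases b
      simp_all

/-- Different instances are written as different strings. -/
theorem encode_injective : Function.Injective encode := by
  rintro ⟨n, P, K⟩ ⟨n', P', K'⟩ h
  simp only [encode, List.append_assoc, List.cons_append, List.nil_append] at h
  have hn : n = n' := by
    have := congrArg List.length (bits_comma_inj h).1
    simpa using this
  subst hn
  obtain ⟨h1, h⟩ := encodeSet_append_inj h
  obtain ⟨h2, h⟩ := encodeSet_append_inj (List.cons.inj h).2
  obtain ⟨h3, h⟩ := encodeSet_append_inj (List.cons.inj h).2
  obtain ⟨h4, h⟩ := encodeSet_append_inj (List.cons.inj h).2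
  obtain ⟨h5, h⟩ := encodeActions_comma_inj (List.cons.inj h).2
  obtain ⟨h6, h⟩ := encodeActions_comma_inj h
  obtain ⟨h7, h⟩ := encodeActions_comma_inj h
  have hb : Function.Injective Γ'.bit := fun a b h => by injection h
  have h8 : K = K' := by
    have := congrArg decodeNat (hb.list_map h)
    simpa using this
  have h9 : P.oracle = P'.oracle := by
    funext f
    have := Finset.ext_iff.1 h4 f
    simp only [Finset.mem_filter, Finset.mem_univ, true_and] at this
    exact Bool.eq_iff_iff.2 this
  subst h8
  obtain ⟨⟨RA⟩, RI, GH, ⟨HA⟩, HI, π, O, _⟩ := P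
  obtain ⟨⟨RA'⟩, RI', GH', ⟨HA'⟩, HI', π', O', _⟩ := P'
  simp only at h1 h2 h3 h5 h6 h7 h9
  subst h1 h2 h3 h5 h6 h7 h9
  rfl

end HAGLInstance

/-! ## Polynomial space and hardness -/

/-- The space a configuration of a multi-stack Turing machine occupies: the total number of symbols
on its stacks. -/
def cfgSpace (M : Turing.FinTM2) (c : M.Cfg) : ℕ :=
  ∑ k ∈ @Finset.univ M.K M.kFin, (Turing.TM2.Cfg.stk c k).length

open Classical in
/-- The language `L` over the alphabet `α` belongs to PSPACE: some Turing machine with finite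
alphabets decides it (it halts on every input with the output `true` or `false`), and during the
computation on an input of length `n` it never occupies more than `p n` space, for some
polynomial `p`. -/
def InPSPACE {α : Type} (L : Language α) : Prop :=
  ∃ (M : Turing.TM2Computable (id : List α → List α) Computability.encodeBool
      (fun w : List α => decide (w ∈ L))) (p : Polynomial ℕ),
    (∀ k, Finite (M.tm.Γ k)) ∧
    ∀ (w : List α) (c : M.tm.Cfg),
      StateTransition.Reaches M.tm.step
        (Turing.initList M.tm (w.map M.inputAlphabet.invFun)) c →
      cfgSpace M.tm c ≤ p.eval w.length

/-- The decision problem with the instances `β`, written as strings by `enc`, and the yes-instances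
`A` is PSPACE-hard: every language in PSPACE, over any finite alphabet, has a polynomial-time
many-one reduction to it. -/
def PSPACEHard {β Γ : Type} (enc : β → List Γ) (A : β → Prop) : Prop :=
  ∀ (α : Type) [Fintype α] (L : Language α), InPSPACE L →
    ∃ f : List α → β,
      Nonempty (Turing.TM2ComputableInPolyTime (id : List α → List α) enc f) ∧
      ∀ w, w ∈ L ↔ A (f w)

/-! Hardness already holds when there is nothing to ask. If the human plan is empty and `humanInit`
and `humanGoal` are both `G`, then `G` is the only compatible goal, and a plan can be returned
within 0 queries iff the robot domain has a plan for `G` (`planWithQueries_singleGoal`). So it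
suffices to reduce PSPACE to STRIPS plan existence, which is done by simulating a space-bounded
machine.

The machine is a deterministic multi-stack machine. A configuration becomes a set of fluents: one
for the control state, and in block `i` the symbols at height `i` above the bottom of each stack,
with a marker in the block just above each top. Because heights are counted from the bottom, a push
or pop changes only two neighbouring blocks. An action is a rule of the machine placed at blocks `h`
and `h + 1`; the marker in its precondition forces `h` to be the right height. A compound statement
is executed one operation at a time, the rest of the statement being part of the control state.
Every simulated stack has `none` at its bottom, so that the empty stack can be tested like a symbol.
The goal is the control state entered by halting with `true` on top of the output stack.

Every executable action sequence follows a computation of the machine (`exec_sound`,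
`Invariant.steps`). Conversely, an accepting computation yields a plan as long as its stacks fit
into the blocks (`simulate_accept`, `exec_complete`); polynomial space is needed only here. Halted
configurations are unique by determinism, so plan existence means acceptance (`exists_plan_iff`).

The instance must also be written in polynomial time. Its string is very regular: blocks of constant
width, almost all zero, and constantly many action templates shifted over polynomially many places.
A small language of push and pop-loop programs with verified time bounds compiles to machines
(`machine_outputs`), and a single program writes all such strings (`Blueprint.prog_does`). The
number of spare blocks is `(n + c) ^ d`, which dominates the space bound (`exists_lt_pow`) and can
be computed in unary. -/

/-! ## Structured programs over stacks -/

namespace StackProgram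

open Turing

variable {K : Type}

/-- Structured programs over stacks with alphabets `Γ k`. The loop pops a symbol off the stack `k`
and runs its body for that symbol, until the stack is empty. -/
inductive Prog (Γ : K → Type) : Type
  | skip : Prog Γ
  | push (k : K) (x : Γ k) : Prog Γ
  | seq (p q : Prog Γ) : Prog Γ
  | loop (k : K) (body : Γ k → Prog Γ) : Prog Γ

variable {Γ : K → Type}

/-- The program points of a program. -/
def Point : Prog Γ → Type
  | .skip => Unit
  | .push _ _ => Unit
  | .seq p q => Point p ⊕ Point q
  | .loop _ body => Option (Σ x, Point (body x))

/-- The program point at which execution starts. -/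
def entry : (p : Prog Γ) → Point p
  | .skip => ()
  | .push _ _ => ()
  | .seq p _ => Sum.inl (entry p)
  | .loop _ _ => none

theorem finite_point [∀ k, Finite (Γ k)] : ∀ p : Prog Γ, Finite (Point p)
  | .skip => inferInstanceAs (Finite Unit)
  | .push _ _ => inferInstanceAs (Finite Unit)
  | .seq p q =>
    have := finite_point p
    have := finite_point q
    inferInstanceAs (Finite (Point p ⊕ Point q))
  | .loop _ body =>
    have := fun x => finite_point (body x)
    inferInstanceAs (Finite (Option (Σ x, Point (body x))))

variable [DecidableEq K]

/-- The symbol read last, if it was read from the stack `k`. -/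
def readFrom (k : K) (v : Option (Σ k, Γ k)) : Option (Γ k) :=
  v.bind fun s => if h : s.1 = k then some (h ▸ s.2) else none

theorem readFrom_map (k : K) (o : Option (Γ k)) : readFrom k (o.map (Sigma.mk k)) = o := by
  cases o <;> simp [readFrom]

/-- The code of a program, with its points embedded among the labels of a machine. -/
def code {Λ : Type} : (p : Prog Γ) → (Point p → Λ) → Λ → Point p →
    TM2.Stmt Γ Λ (Option (Σ k, Γ k))
  | .skip, _, exit, _ => .goto fun _ => exit
  | .push k x, _, exit, _ => .push k (fun _ => x) (.goto fun _ => exit)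
  | .seq p q, emb, exit, l =>
    match l with
    | .inl l => code p (emb ∘ Sum.inl) (emb (.inr (entry q))) l
    | .inr l => code q (emb ∘ Sum.inr) exit l
  | .loop k body, emb, exit, l =>
    match l with
    | none => .pop k (fun _ o => o.map (Sigma.mk k)) (.goto fun v =>
        (readFrom k v).elim exit fun x => emb (some ⟨x, entry (body x)⟩))
    | some ⟨x, l⟩ => code (body x) (fun l => emb (some ⟨x, l⟩)) (emb none) l

/-- The machine `m` gets from one configuration to another in at most `t` steps. -/
def RunsIn {Λ σ : Type} (m : Λ → TM2.Stmt Γ Λ σ) (t : ℕ) (c c' : TM2.Cfg Γ Λ σ) : Prop :=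
  ∃ n ≤ t, (flip bind (TM2.step m))^[n] (some c) = some c'

theorem RunsIn.trans {Λ σ : Type} {m : Λ → TM2.Stmt Γ Λ σ} {t u : ℕ} {c c' c'' : TM2.Cfg Γ Λ σ}
    (h : RunsIn m t c c') (h' : RunsIn m u c' c'') : RunsIn m (t + u) c c'' := by
  obtain ⟨i, hi, h⟩ := h
  obtain ⟨j, hj, h'⟩ := h'
  exact ⟨j + i, by omega, by rw [Function.iterate_add_apply, h, h']⟩

theorem RunsIn.single {Λ σ : Type} {m : Λ → TM2.Stmt Γ Λ σ} {c c' : TM2.Cfg Γ Λ σ}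
    (h : TM2.step m c = some c') : RunsIn m 1 c c' :=
  ⟨1, le_rfl, h⟩

/-- Wherever the program `p` stands in a machine, the machine gets through it in at most `t` steps,
turning the stacks `s` into `s'`. -/
structure Does (p : Prog Γ) (s s' : ∀ k, List (Γ k)) (t : ℕ) : Prop where
  run : ∀ {Λ : Type} (m : Λ → TM2.Stmt Γ Λ (Option (Σ k, Γ k))) (emb : Point p → Λ) (exit : Λ),
    (∀ l, m (emb l) = code p emb exit l) →
    ∀ v, ∃ v', RunsIn m t ⟨some (emb (entry p)), v, s⟩ ⟨some exit, v', s'⟩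

variable {s s' s'' : ∀ k, List (Γ k)} {t t' : ℕ}

theorem Does.mono {p : Prog Γ} (h : Does p s s' t) (ht : t ≤ t') : Does p s s' t' := by
  refine ⟨fun m emb exit hm v => ?_⟩
  obtain ⟨v', n, hn, h⟩ := h.run m emb exit hm v
  exact ⟨v', n, hn.trans ht, h⟩

theorem Does.skip : Does (Γ := Γ) .skip s s 1 :=
  ⟨fun m emb exit hm v => ⟨v, .single (by simp [TM2.step, hm, code])⟩⟩

theorem Does.push {k : K} {x : Γ k} (hk : s' k = x :: s k) (h : ∀ j, j ≠ k → s' j = s j) :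
    Does (.push k x) s s' 1 := by
  refine ⟨fun m emb exit hm v => ?_⟩
  refine ⟨v, .single ?_⟩
  have : Function.update s k (x :: s k) = s' := by
    funext j
    by_cases hj : j = k
    · subst hj; simp [hk]
    · simp [hj, h j hj]
  simp [TM2.step, hm, code, this]

theorem Does.seq {p q : Prog Γ} (hp : Does p s s' t) (hq : Does q s' s'' t') :
    Does (.seq p q) s s'' (t + t') := by
  refine ⟨fun m emb exit hm v => ?_⟩
  obtain ⟨v', h⟩ := hp.run m (emb ∘ Sum.inl) (emb (.inr (entry q))) (fun l => hm (.inl l)) v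
  obtain ⟨v'', h'⟩ := hq.run m (emb ∘ Sum.inr) exit (fun l => hm (.inr l)) v'
  exact ⟨v'', h.trans h'⟩

theorem Does.loop_nil {k : K} {body : Γ k → Prog Γ} (hk : s k = []) :
    Does (.loop k body) s s 1 := by
  refine ⟨fun m emb exit hm v => ?_⟩
  refine ⟨none, .single ?_⟩
  have : Function.update s k [] = s := by rw [← hk, Function.update_eq_self]
  have h0 : readFrom (Γ := Γ) k none = none := rfl
  have hm0 := hm none
  simp only [code] at hm0
  simp [TM2.step, entry, hm0, hk, this, h0]

/-- The exit of the body is the loop head itself, so one pop, one run of the body and the remaining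
loop are simply concatenated. The stacks `s₁` are those just after the pop. -/
theorem Does.loop_cons {k : K} {body : Γ k → Prog Γ} {x : Γ k} {s₁ : ∀ k, List (Γ k)}
    (hk : s k = x :: s₁ k) (h : ∀ j, j ≠ k → s₁ j = s j)
    (hb : Does (body x) s₁ s' t) (hl : Does (.loop k body) s' s'' t') :
    Does (.loop k body) s s'' (1 + (t + t')) := by
  refine ⟨fun m emb exit hm v => ?_⟩
  obtain ⟨v', h1⟩ := hb.run m (fun l => emb (some ⟨x, l⟩)) (emb none) (fun l => hm (some ⟨x, l⟩))
    (some ⟨k, x⟩)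
  obtain ⟨v'', h2⟩ := hl.run m emb exit hm v'
  refine ⟨v'', .trans (.single ?_) (h1.trans h2)⟩
  have : Function.update s k (s₁ k) = s₁ := by
    funext j
    by_cases hj : j = k
    · subst hj; simp
    · simp [hj, h j hj]
  have h0 := readFrom_map k (some x)
  simp only [Option.map_some] at h0
  have hm0 := hm none
  simp only [code] at hm0
  simp [TM2.step, entry, hm0, hk, this, h0]

/-- The machine that runs a program and halts. -/
noncomputable def machine [Fintype K] [∀ k, Finite (Γ k)] (p : Prog Γ) (k₀ k₁ : K) : FinTM2 :=
  have : Finite (Point p) := finite_point p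
  { K := K
    k₀ := k₀
    k₁ := k₁
    Γ := Γ
    Λ := Option (Point p)
    main := some (entry p)
    ΛFin := Fintype.ofFinite _
    σ := Option (Σ k, Γ k)
    initialState := none
    σFin := Fintype.ofFinite _
    Γk₀Fin := Fintype.ofFinite _
    -- `haltList` prescribes the initial internal state, so the exit label resets it before halting.
    m := fun l => l.elim (.load (fun _ => none) .halt) (code p some none) }

/-- The stacks that are empty except for the stack `k`. -/
def onlyStack (k : K) (l : List (Γ k)) : ∀ k, List (Γ k) :=
  Function.update (fun _ => []) k l

theorem onlyStack_eq (k : K) (l : List (Γ k)) (j : K) :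
    onlyStack k l j = if h : j = k then (by rw [h]; exact l) else [] := by
  by_cases h : j = k
  · subst h; simp [onlyStack]
  · simp [onlyStack, h]

/-- The additional step is the one at the exit label, which resets the internal state and halts. -/
theorem machine_outputs [Fintype K] [∀ k, Finite (Γ k)] {p : Prog Γ} {k₀ k₁ : K}
    {l : List (Γ k₀)} {l' : List (Γ k₁)}
    (h : Does p (onlyStack k₀ l) (onlyStack k₁ l') t) :
    Nonempty (TM2OutputsInTime (machine p k₀ k₁) l (some l') (t + 1)) := by
  obtain ⟨v', h⟩ := h.run (machine p k₀ k₁).m some none (fun _ => rfl) none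
  have h1 := h.trans (RunsIn.single (c' := ⟨none, none, onlyStack k₁ l'⟩) (by
    simp [TM2.step, machine]))
  obtain ⟨n, hn, h2⟩ := h1
  have e0 : initList (machine p k₀ k₁) l = ⟨some (some (entry p)), none, onlyStack k₀ l⟩ := by
    simp only [initList]
    congr 1
    funext j
    exact (onlyStack_eq k₀ l j).symm
  have e1 : haltList (machine p k₀ k₁) l' = ⟨none, none, onlyStack k₁ l'⟩ := by
    simp only [haltList]
    congr 1
    funext j
    exact (onlyStack_eq k₁ l' j).symm
  refine ⟨⟨⟨n, ?_⟩, hn⟩⟩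
  have h3 : (flip bind (machine p k₀ k₁).step)^[n] (some (initList (machine p k₀ k₁) l)) =
      some (haltList (machine p k₀ k₁) l') := by
    rw [e0, e1]
    exact h2
  exact h3

end StackProgram

/-! ## A program that writes planning problems -/

namespace Emitter

open Computability StackProgram

/-- The stacks of the emitter: the input, the reversed input, the output, and unary counters. -/
inductive Reg
  | inp | rev | out | n | e | t | u | a | b
deriving DecidableEq

instance : Fintype Reg :=
  ⟨{.inp, .rev, .out, .n, .e, .t, .u, .a, .b}, fun r => by cases r <;> simp⟩

/-- The alphabets of the stacks. -/
abbrev Alph (α : Type) : Reg → Type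
  | .inp => α
  | .rev => α
  | .out => Γ'
  | _ => Unit

variable {α : Type}

instance [Finite α] : ∀ r, Finite (Alph α r)
  | .inp => inferInstanceAs (Finite α)
  | .rev => inferInstanceAs (Finite α)
  | .out => inferInstanceAs (Finite Γ')
  | .n => inferInstanceAs (Finite Unit)
  | .e => inferInstanceAs (Finite Unit)
  | .t => inferInstanceAs (Finite Unit)
  | .u => inferInstanceAs (Finite Unit)
  | .a => inferInstanceAs (Finite Unit)
  | .b => inferInstanceAs (Finite Unit)

/-- The stacks with the given contents. -/
def regs (inp rev : List α) (out : List Γ') (n e t u a b : ℕ) : ∀ r, List (Alph α r)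
  | .inp => inp
  | .rev => rev
  | .out => out
  | .n => List.replicate n ()
  | .e => List.replicate e ()
  | .t => List.replicate t ()
  | .u => List.replicate u ()
  | .a => List.replicate a ()
  | .b => List.replicate b ()

/-! ### Writing strings, and copying unary counters -/

variable {i r : List α} {o : List Γ'} {n e t u a b c d : ℕ}

/-- `k` zeros. -/
def zeros (k : ℕ) : List Γ' := List.replicate k (Γ'.bit false)

theorem length_zeros (k : ℕ) : (zeros k).length = k := List.length_replicate

theorem zeros_mul_succ (c k : ℕ) : zeros (c * (k + 1)) = zeros (c * k) ++ zeros c := by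
  rw [zeros, zeros, zeros, List.replicate_append_replicate, Nat.mul_succ]

/-- Write a fixed string in front of the output. -/
def emit : List Γ' → Prog (Alph α)
  | [] => .skip
  | x :: l => .seq (emit l) (.push .out x)

/-- The output is a stack, so everything is written from its end to its beginning: the tail of the
string is pushed before its head. -/
theorem emit_does (l : List Γ') :
    Does (emit l) (regs i r o n e t u a b) (regs i r (l ++ o) n e t u a b) (l.length + 1) := by
  induction l with
  | nil => exact .skip
  | cons x l ih =>
    refine ih.seq (.push (s' := regs i r (x :: (l ++ o)) n e t u a b) rfl ?_)
    intro j hj; cases j <;> first | rfl | exact absurd rfl hj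

/-- Write `c` zeros for each unit of the counter `a`, and restore the counter. -/
def fillA (c : ℕ) : Prog (Alph α) :=
  .seq (.loop .a fun _ => .seq (emit (zeros c)) (.push .t ())) (.loop .t fun _ => .push .a ())

/-- Write `c` zeros for each unit of the counter `b`, and restore the counter. -/
def fillB (c : ℕ) : Prog (Alph α) :=
  .seq (.loop .b fun _ => .seq (emit (zeros c)) (.push .t ())) (.loop .t fun _ => .push .b ())

/-- Loops destroy the counter they run on. A counter that is needed again is therefore copied to a
spare one during the loop and then moved back; this lemma and its variants are the moving back. -/
theorem move_t_a :
    Does (.loop .t fun _ => .push .a ()) (regs i r o n e t u a b) (regs i r o n e 0 u (a + t) b)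
      (2 * t + 1) := by
  induction t generalizing a with
  | zero => exact .loop_nil rfl
  | succ t ih =>
    have h := ih (a := a + 1)
    rw [show a + 1 + t = a + (t + 1) by omega] at h
    refine (Does.loop_cons (body := fun _ => .push .a ()) (x := ()) (s₁ := regs i r o n e t u a b)
      (s' := regs i r o n e t u (a + 1) b) rfl ?_ (.push rfl ?_) h).mono (by omega) <;>
    · intro j hj; cases j <;> first | rfl | exact absurd rfl hj

theorem move_t_b :
    Does (.loop .t fun _ => .push .b ()) (regs i r o n e t u a b) (regs i r o n e 0 u a (b + t))
      (2 * t + 1) := by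
  induction t generalizing b with
  | zero => exact .loop_nil rfl
  | succ t ih =>
    have h := ih (b := b + 1)
    rw [show b + 1 + t = b + (t + 1) by omega] at h
    refine (Does.loop_cons (body := fun _ => .push .b ()) (x := ()) (s₁ := regs i r o n e t u a b)
      (s' := regs i r o n e t u a (b + 1)) rfl ?_ (.push rfl ?_) h).mono (by omega) <;>
    · intro j hj; cases j <;> first | rfl | exact absurd rfl hj

theorem move_t_n :
    Does (.loop .t fun _ => .push .n ()) (regs i r o n e t u a b) (regs i r o (n + t) e 0 u a b)
      (2 * t + 1) := by
  induction t generalizing n with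
  | zero => exact .loop_nil rfl
  | succ t ih =>
    have h := ih (n := n + 1)
    rw [show n + 1 + t = n + (t + 1) by omega] at h
    refine (Does.loop_cons (body := fun _ => .push .n ()) (x := ()) (s₁ := regs i r o n e t u a b)
      (s' := regs i r o (n + 1) e t u a b) rfl ?_ (.push rfl ?_) h).mono (by omega) <;>
    · intro j hj; cases j <;> first | rfl | exact absurd rfl hj

theorem move_t_e :
    Does (.loop .t fun _ => .push .e ()) (regs i r o n e t u a b) (regs i r o n (e + t) 0 u a b)
      (2 * t + 1) := by
  induction t generalizing e with
  | zero => exact .loop_nil rfl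
  | succ t ih =>
    have h := ih (e := e + 1)
    rw [show e + 1 + t = e + (t + 1) by omega] at h
    refine (Does.loop_cons (body := fun _ => .push .e ()) (x := ()) (s₁ := regs i r o n e t u a b)
      (s' := regs i r o n (e + 1) t u a b) rfl ?_ (.push rfl ?_) h).mono (by omega) <;>
    · intro j hj; cases j <;> first | rfl | exact absurd rfl hj

theorem move_u_n :
    Does (.loop .u fun _ => .push .n ()) (regs i r o n e t u a b) (regs i r o (n + u) e t 0 a b)
      (2 * u + 1) := by
  induction u generalizing n with
  | zero => exact .loop_nil rfl
  | succ u ih =>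
    have h := ih (n := n + 1)
    rw [show n + 1 + u = n + (u + 1) by omega] at h
    refine (Does.loop_cons (body := fun _ => .push .n ()) (x := ()) (s₁ := regs i r o n e t u a b)
      (s' := regs i r o (n + 1) e t u a b) rfl ?_ (.push rfl ?_) h).mono (by omega) <;>
    · intro j hj; cases j <;> first | rfl | exact absurd rfl hj

theorem move_e_t :
    Does (.loop .e fun _ => .push .t ()) (regs i r o n e t u a b) (regs i r o n 0 (t + e) u a b)
      (2 * e + 1) := by
  induction e generalizing t with
  | zero => exact .loop_nil rfl
  | succ e ih =>
    have h := ih (t := t + 1)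
    rw [show t + 1 + e = t + (e + 1) by omega] at h
    refine (Does.loop_cons (body := fun _ => .push .t ()) (x := ()) (s₁ := regs i r o n e t u a b)
      (s' := regs i r o n e (t + 1) u a b) rfl ?_ (.push rfl ?_) h).mono (by omega) <;>
    · intro j hj; cases j <;> first | rfl | exact absurd rfl hj

theorem fillA_does :
    Does (fillA c) (regs i r o n e 0 u a b) (regs i r (zeros (c * a) ++ o) n e 0 u a b)
      (a * (c + 5) + 2) := by
  have key : ∀ a t o, Does (.loop .a fun _ => .seq (emit (zeros c)) (.push .t ()))
      (regs i r o n e t u a b) (regs i r (zeros (c * a) ++ o) n e (t + a) u 0 b)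
      (a * (c + 3) + 1) := by
    intro a
    induction a with
    | zero => intro t o; exact .mono (.loop_nil rfl) (by omega)
    | succ a ih =>
      intro t o
      have h := ih (t + 1) (zeros c ++ o)
      rw [show t + 1 + a = t + (a + 1) by omega, ← List.append_assoc, ← zeros_mul_succ] at h
      refine (Does.loop_cons (x := ()) (s₁ := regs i r o n e t u a b) rfl ?_
        ((emit_does _).seq (s'' := regs i r (zeros c ++ o) n e (t + 1) u a b)
          (.push rfl ?_)) h).mono (by rw [length_zeros]; ring_nf; omega) <;>
      · intro j hj; cases j <;> first | rfl | exact absurd rfl hj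
  have h := (key a 0 o).seq move_t_a
  simp only [zero_add] at h
  exact h.mono (by ring_nf; omega)

theorem fillB_does :
    Does (fillB c) (regs i r o n e 0 u a b) (regs i r (zeros (c * b) ++ o) n e 0 u a b)
      (b * (c + 5) + 2) := by
  have key : ∀ b t o, Does (.loop .b fun _ => .seq (emit (zeros c)) (.push .t ()))
      (regs i r o n e t u a b) (regs i r (zeros (c * b) ++ o) n e (t + b) u a 0)
      (b * (c + 3) + 1) := by
    intro b
    induction b with
    | zero => intro t o; exact .mono (.loop_nil rfl) (by omega)
    | succ b ih =>
      intro t o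
      have h := ih (t + 1) (zeros c ++ o)
      rw [show t + 1 + b = t + (b + 1) by omega, ← List.append_assoc, ← zeros_mul_succ] at h
      refine (Does.loop_cons (x := ()) (s₁ := regs i r o n e t u a b) rfl ?_
        ((emit_does _).seq (s'' := regs i r (zeros c ++ o) n e (t + 1) u a b)
          (.push rfl ?_)) h).mono (by rw [length_zeros]; ring_nf; omega) <;>
      · intro j hj; cases j <;> first | rfl | exact absurd rfl hj
  have h := (key b 0 o).seq move_t_b
  simp only [zero_add] at h
  exact h.mono (by ring_nf; omega)

/-! ### Computing a power of the input length -/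

/-- Add `c` to the counter `e`. -/
def addConst : ℕ → Prog (Alph α)
  | 0 => .skip
  | c + 1 => .seq (addConst c) (.push .e ())

theorem addConst_does :
    Does (addConst c) (regs i r o n e t u a b) (regs i r o n (e + c) t u a b) (c + 1) := by
  induction c with
  | zero => exact .skip
  | succ c ih =>
    exact ih.seq (.push rfl (by intro j hj; cases j <;> first | rfl | exact absurd rfl hj))

/-- Add the counter `n` to the counter `e`. -/
def addLength : Prog (Alph α) :=
  .seq (.loop .n fun _ => .seq (.push .e ()) (.push .u ())) (.loop .u fun _ => .push .n ())

theorem addLength_does :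
    Does addLength (regs i r o n e t 0 a b) (regs i r o n (e + n) t 0 a b) (5 * n + 2) := by
  have key : ∀ n e u, Does (.loop .n fun _ => .seq (.push .e ()) (.push .u ()))
      (regs i r o n e t u a b) (regs i r o 0 (e + n) t (u + n) a b) (3 * n + 1) := by
    intro n
    induction n with
    | zero => intro e u; exact .loop_nil rfl
    | succ n ih =>
      intro e u
      have h := ih (e + 1) (u + 1)
      rw [show e + 1 + n = e + (n + 1) by omega, show u + 1 + n = u + (n + 1) by omega] at h
      refine (Does.loop_cons (x := ()) (s₁ := regs i r o n e t u a b) rfl ?_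
        (Does.seq (s' := regs i r o n (e + 1) t u a b) (.push rfl ?_)
          (.push (s' := regs i r o n (e + 1) t (u + 1) a b) rfl ?_)) h).mono (by omega) <;>
      · intro j hj; cases j <;> first | rfl | exact absurd rfl hj
  have h := (key n e 0).seq move_u_n
  simp only [zero_add] at h
  exact h.mono (by omega)

/-- Multiply the counter `e` by `n + c`. -/
def mulLength (c : ℕ) : Prog (Alph α) :=
  .seq (.loop .e fun _ => .push .t ()) (.loop .t fun _ => .seq (addConst c) addLength)

theorem mulLength_does :
    Does (mulLength c) (regs i r o n e 0 0 a b) (regs i r o n (e * (n + c)) 0 0 a b)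
      (e * (c + 5 * n + 6) + 2) := by
  -- With the old value of `e` moved to `t`, each unit of `t` contributes `n + c` to the new one.
  have key : ∀ t e, Does (.loop .t fun _ => .seq (addConst c) addLength)
      (regs i r o n e t 0 a b) (regs i r o n (e + t * (n + c)) 0 0 a b)
      (t * (c + 5 * n + 4) + 1) := by
    intro t
    induction t with
    | zero => intro e; simpa using Does.loop_nil rfl
    | succ t ih =>
      intro e
      have h := ih (e + c + n)
      rw [show e + c + n + t * (n + c) = e + (t + 1) * (n + c) by ring] at h
      refine (Does.loop_cons (x := ()) (s₁ := regs i r o n e t 0 a b) rfl ?_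
        (addConst_does.seq addLength_does) h).mono (by ring_nf; omega)
      intro j hj; cases j <;> first | rfl | exact absurd rfl hj
  have h := move_e_t.seq (key (0 + e) 0)
  simp only [zero_add] at h
  exact h.mono (by ring_nf; omega)

/-- Set the counter `e` to `(n + c) ^ d`. -/
def power (c : ℕ) : ℕ → Prog (Alph α)
  | 0 => .push .e ()
  | d + 1 => .seq (power c d) (mulLength c)

/-- The time taken by `power`. -/
def powerTime (c n : ℕ) : ℕ → ℕ
  | 0 => 1
  | d + 1 => powerTime c n d + ((n + c) ^ d * (c + 5 * n + 6) + 2)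

theorem power_does :
    Does (power c d) (regs i r o n 0 0 0 a b) (regs i r o n ((n + c) ^ d) 0 0 a b)
      (powerTime c n d) := by
  induction d with
  | zero => exact .push rfl (by intro j hj; cases j <;> first | rfl | exact absurd rfl hj)
  | succ d ih => exact ih.seq mulLength_does

/-! ### Reading the input -/

/-- Count the symbols of the input, leaving the input as it is. -/
def measure : Prog (Alph α) :=
  .seq (.loop .inp fun x => .seq (.push .rev x) (.push .n ())) (.loop .rev fun x => .push .inp x)

theorem measure_does :
    Does measure (regs i [] o 0 e t u a b) (regs i [] o i.length e t u a b)
      (5 * i.length + 2) := by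
  have key1 : ∀ (i r : List α) n,
      Does (.loop .inp fun x => .seq (.push .rev x) (.push .n ()))
        (regs i r o n e t u a b) (regs [] (i.reverse ++ r) o (n + i.length) e t u a b)
        (3 * i.length + 1) := by
    intro i
    induction i with
    | nil => intro r n; exact .loop_nil rfl
    | cons x i ih =>
      intro r n
      have h := ih (x :: r) (n + 1)
      rw [show n + 1 + i.length = n + (x :: i).length by simp; omega,
        show i.reverse ++ x :: r = (x :: i).reverse ++ r by simp] at h
      refine (Does.loop_cons (x := x) (s₁ := regs i r o n e t u a b) rfl ?_
        (Does.seq (s' := regs i (x :: r) o n e t u a b) (.push rfl ?_)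
          (.push (s' := regs i (x :: r) o (n + 1) e t u a b) rfl ?_)) h).mono
          (by simp only [List.length_cons]; omega) <;>
      · intro j hj; cases j <;> first | rfl | exact absurd rfl hj
  have key2 : ∀ (r i : List α) n,
      Does (.loop .rev fun x => .push .inp x)
        (regs i r o n e t u a b) (regs (r.reverse ++ i) [] o n e t u a b) (2 * r.length + 1) := by
    intro r
    induction r with
    | nil => intro i n; exact .loop_nil rfl
    | cons x r ih =>
      intro i n
      have h := ih (x :: i) n
      rw [show r.reverse ++ x :: i = (x :: r).reverse ++ i by simp] at h
      refine Does.mono (Does.loop_cons (k := .rev) (body := fun x => .push .inp x) (x := x)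
        (s := regs i (x :: r) o n e t u a b) (s₁ := regs i r o n e t u a b)
        (s' := regs (x :: i) r o n e t u a b) (t := 1) rfl ?_ (.push rfl ?_) h)
          (by simp only [List.length_cons]; omega) <;>
      · intro j hj; cases j <;> first | rfl | exact absurd rfl hj
  have h := (key1 i [] 0).seq (key2 (i.reverse ++ []) [] (0 + i.length))
  simp only [List.append_nil, List.reverse_reverse, zero_add, List.length_reverse] at h
  exact h.mono (by omega)

/-- Set the counter `b` to `n + e + 2`. -/
def bound : Prog (Alph α) :=
  .seq (.loop .n fun _ => .seq (.push .t ()) (.push .b ()))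
    (.seq (.loop .t fun _ => .push .n ())
      (.seq (.loop .e fun _ => .seq (.push .t ()) (.push .b ()))
        (.seq (.loop .t fun _ => .push .e ()) (.seq (.push .b ()) (.push .b ())))))

theorem bound_does :
    Does bound (regs i r o n e 0 u a 0) (regs i r o n e 0 u a (n + e + 2))
      (5 * n + 5 * e + 6) := by
  have key1 : ∀ n t b, Does (.loop .n fun _ => .seq (.push .t ()) (.push .b ()))
      (regs i r o n e t u a b) (regs i r o 0 e (t + n) u a (b + n)) (3 * n + 1) := by
    intro n
    induction n with
    | zero => intro t b; exact .loop_nil rfl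
    | succ n ih =>
      intro t b
      have h := ih (t + 1) (b + 1)
      rw [show t + 1 + n = t + (n + 1) by omega, show b + 1 + n = b + (n + 1) by omega] at h
      refine (Does.loop_cons (x := ()) (s₁ := regs i r o n e t u a b) rfl ?_
        (Does.seq (s' := regs i r o n e (t + 1) u a b) (.push rfl ?_)
          (.push (s' := regs i r o n e (t + 1) u a (b + 1)) rfl ?_)) h).mono (by omega) <;>
      · intro j hj; cases j <;> first | rfl | exact absurd rfl hj
  have key2 : ∀ e t b, Does (.loop .e fun _ => .seq (.push .t ()) (.push .b ()))
      (regs i r o n e t u a b) (regs i r o n 0 (t + e) u a (b + e)) (3 * e + 1) := by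
    intro e
    induction e with
    | zero => intro t b; exact .loop_nil rfl
    | succ e ih =>
      intro t b
      have h := ih (t + 1) (b + 1)
      rw [show t + 1 + e = t + (e + 1) by omega, show b + 1 + e = b + (e + 1) by omega] at h
      refine (Does.loop_cons (x := ()) (s₁ := regs i r o n e t u a b) rfl ?_
        (Does.seq (s' := regs i r o n e (t + 1) u a b) (.push rfl ?_)
          (.push (s' := regs i r o n e (t + 1) u a (b + 1)) rfl ?_)) h).mono (by omega) <;>
      · intro j hj; cases j <;> first | rfl | exact absurd rfl hj
  have h1 := key1 n 0 0
  have h2 := move_t_n (i := i) (r := r) (o := o) (n := 0) (e := e) (t := n) (u := u) (a := a)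
    (b := n)
  have h3 := key2 e 0 n
  have h4 := move_t_e (i := i) (r := r) (o := o) (n := n) (e := 0) (t := e) (u := u) (a := a)
    (b := n + e)
  simp only [zero_add] at h1 h2 h3 h4
  refine (h1.seq (h2.seq (h3.seq (h4.seq (Does.seq (s' := regs i r o n e 0 u a (n + e + 1))
    (.push rfl ?_) (.push rfl ?_)))))).mono (by omega) <;>
  · intro j hj; cases j <;> first | rfl | exact absurd rfl hj

/-! ### Writing actions -/

/-- A set of fluents that refers to the global fluents and to two consecutive blocks, given by the
bits of these. -/
structure Pattern where
  glob : List Γ'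
  win : List Γ'

/-- The pattern placed after `lo` blocks of length `c`, and followed by `hi` blocks. -/
def Pattern.str (c : ℕ) (P : Pattern) (lo hi : ℕ) : List Γ' :=
  P.glob ++ zeros (c * lo) ++ P.win ++ zeros (c * hi)

/-- Write a pattern after `b` and before `a` blocks. -/
def Pattern.prog (c : ℕ) (P : Pattern) : Prog (Alph α) :=
  .seq (fillA c) (.seq (emit P.win) (.seq (fillB c) (emit P.glob)))

/-- The time for writing a pattern, where `m = a + b`. -/
def Pattern.time (c : ℕ) (P : Pattern) (m : ℕ) : ℕ :=
  m * (c + 5) + (P.glob.length + P.win.length + 6)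

/-- Writing backwards, the `a` empty blocks behind the window come first and the global bits come
last. -/
theorem Pattern.prog_does (P : Pattern) :
    Does (P.prog c) (regs i r o n e 0 u a b) (regs i r (P.str c b a ++ o) n e 0 u a b)
      (P.time c (a + b)) := by
  have h := fillA_does (i := i) (r := r) (o := o) (n := n) (e := e) (u := u) (a := a) (b := b)
    (c := c) |>.seq ((emit_does P.win).seq ((fillB_does (c := c)).seq (emit_does P.glob)))
  simp only [← List.append_assoc] at h
  exact h.mono (by rw [Pattern.time]; ring_nf; omega)

/-- The patterns of an action. -/
structure Template where
  pre : Pattern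
  add : Pattern
  del : Pattern

/-- The action that a template describes, as a string. -/
def Template.str (c : ℕ) (τ : Template) (lo hi : ℕ) : List Γ' :=
  [Γ'.bra] ++ τ.pre.str c lo hi ++ [Γ'.comma] ++ τ.add.str c lo hi ++ [Γ'.comma] ++
    τ.del.str c lo hi ++ [Γ'.ket]

/-- Write an action. -/
def Template.prog (c : ℕ) (τ : Template) : Prog (Alph α) :=
  .seq (emit [Γ'.ket]) (.seq (τ.del.prog c) (.seq (emit [Γ'.comma]) (.seq (τ.add.prog c)
    (.seq (emit [Γ'.comma]) (.seq (τ.pre.prog c) (emit [Γ'.bra]))))))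

/-- The time for writing an action. -/
def Template.time (c : ℕ) (τ : Template) (m : ℕ) : ℕ :=
  τ.pre.time c m + τ.add.time c m + τ.del.time c m + 8

theorem Template.prog_does (τ : Template) :
    Does (τ.prog c) (regs i r o n e 0 u a b) (regs i r (τ.str c b a ++ o) n e 0 u a b)
      (τ.time c (a + b)) := by
  have h := (emit_does (i := i) (r := r) (o := o) (n := n) (e := e) (t := 0) (u := u) (a := a)
    (b := b) [Γ'.ket]).seq (τ.del.prog_does (c := c) |>.seq ((emit_does [Γ'.comma]).seq
    (τ.add.prog_does (c := c) |>.seq ((emit_does [Γ'.comma]).seq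
    (τ.pre.prog_does (c := c) |>.seq (emit_does [Γ'.bra]))))))
  simp only [← List.append_assoc] at h
  exact h.mono (by simp only [Template.time, List.length_singleton]; omega)

/-- Write the actions of several templates. -/
def templatesProg (c : ℕ) : List Template → Prog (Alph α)
  | [] => .skip
  | τ :: l => .seq (templatesProg c l) (τ.prog c)

/-- The time for writing the actions of several templates. -/
def templatesTime (c : ℕ) (m : ℕ) : List Template → ℕ
  | [] => 1
  | τ :: l => templatesTime c m l + τ.time c m

theorem templatesProg_does (l : List Template) :
    Does (templatesProg c l) (regs i r o n e 0 u a b)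
      (regs i r (l.flatMap (fun τ => τ.str c b a) ++ o) n e 0 u a b)
      (templatesTime c (a + b) l) := by
  induction l with
  | nil => exact .skip
  | cons τ l ih =>
    have h := ih.seq (τ.prog_does (c := c))
    rw [← List.append_assoc] at h
    exact h

/-- Write the actions of the templates at all places. -/
def actionsProg (c : ℕ) (l : List Template) : Prog (Alph α) :=
  .loop .b fun _ => .seq (templatesProg c l) (.push .a ())

/-- The actions of the templates at the places `0, …, k - 1` among `m + 1` places. -/
def actionsStr (c : ℕ) (l : List Template) (m k : ℕ) : List Γ' :=
  (List.range k).flatMap fun h => l.flatMap fun τ => τ.str c h (m - h)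

/-- Popping a unit of `b` leaves `a + b = m`, so each action is written with `b` blocks before and
`a` blocks after its window. Places are visited from the highest to the lowest, which backward
writing turns into increasing order. At the end `a` holds the number of places, ready for writing
the goal. -/
theorem actionsProg_does (l : List Template) {m : ℕ} (hm : a + b = m + 1) :
    Does (actionsProg c l) (regs i r o n e 0 u a b)
      (regs i r (actionsStr c l m b ++ o) n e 0 u (m + 1) 0)
      (b * (templatesTime c m l + 2) + 1) := by
  induction b generalizing a o with
  | zero =>
    rw [add_zero] at hm
    subst hm
    exact (Does.loop_nil rfl).mono (by omega)
  | succ b ih =>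
    have h := ih (a := a + 1) (o := l.flatMap (fun τ => τ.str c b a) ++ o) (by omega)
    have e1 : actionsStr c l m b ++ (l.flatMap (fun τ => τ.str c b a) ++ o) =
        actionsStr c l m (b + 1) ++ o := by
      rw [actionsStr, actionsStr, List.range_succ, List.flatMap_append, List.append_assoc,
        List.flatMap_singleton, show m - b = a by omega]
    rw [e1] at h
    refine (Does.loop_cons (x := ()) (s₁ := regs i r o n e 0 u a b) rfl ?_
      (Does.seq (s'' := regs i r (l.flatMap (fun τ => τ.str c b a) ++ o) n e 0 u (a + 1) b)
        (templatesProg_does l) (.push rfl ?_)) h).mono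
      (by rw [show a + b = m by omega]; ring_nf; omega) <;>
    · intro j hj; cases j <;> first | rfl | exact absurd rfl hj

/-! ### The whole program -/

/-- The strings from which the output is composed: `width` is the length of a block, `goal` and
`start` are written before the blocks, `cell x` is the block for an input symbol, and `mark` the
block behind the input. -/
structure Blueprint (α : Type) where
  width : ℕ
  offset : ℕ
  degree : ℕ
  goal : List Γ'
  start : List Γ'
  cell : α → List Γ'
  length_cell : ∀ x, (cell x).length = width
  mark : List Γ'
  templates : List Template

namespace Blueprint

variable (S : Blueprint α)

/-- The number of blocks left free behind the input. -/
def slack (n : ℕ) : ℕ := (n + S.offset) ^ S.degree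

/-- The number of places for actions. -/
def places (n : ℕ) : ℕ := n + S.slack n + 2

/-- The string for the goal. -/
def goalStr (n : ℕ) : List Γ' := S.goal ++ zeros (S.width * (S.places n + 1))

/-- The string for the initial state. -/
def startStr (w : List α) : List Γ' :=
  S.start ++ (w.reverse.flatMap S.cell ++ (S.mark ++ zeros (S.width * S.slack w.length)))

/-- The output. -/
def output (w : List α) : List Γ' :=
  S.startStr w ++ [Γ'.comma] ++ S.goalStr w.length ++ [Γ'.comma] ++ S.goalStr w.length ++
    [Γ'.comma] ++ S.goalStr w.length ++ [Γ'.comma] ++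
    actionsStr S.width S.templates (S.places w.length - 1) (S.places w.length) ++
    [Γ'.comma, Γ'.comma, Γ'.comma]

/-- Write the goal, and a comma behind it. -/
def goalProg : Prog (Alph α) :=
  .seq (emit [Γ'.comma]) (.seq (fillA S.width) (emit (S.goal ++ zeros S.width)))

/-- The time for writing the goal, where `m` is the number of places. -/
def goalTime (m : ℕ) : ℕ := m * (S.width + 5) + (S.goal.length + S.width + 5)

theorem goalProg_does :
    Does S.goalProg (regs i r o n e 0 u a b)
      (regs i r (S.goal ++ zeros (S.width * (a + 1)) ++ ([Γ'.comma] ++ o)) n e 0 u a b)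
      (S.goalTime a) := by
  have h := (emit_does (i := i) (r := r) (o := o) (n := n) (e := e) (t := 0) (u := u) (a := a)
    (b := b) [Γ'.comma]).seq ((fillA_does (c := S.width)).seq (emit_does (S.goal ++ zeros S.width)))
  have h1 : S.goal ++ zeros S.width ++ (zeros (S.width * a) ++ ([Γ'.comma] ++ o)) =
      S.goal ++ zeros (S.width * (a + 1)) ++ ([Γ'.comma] ++ o) := by
    have : zeros S.width ++ zeros (S.width * a) = zeros (S.width * (a + 1)) := by
      rw [zeros, zeros, zeros, List.replicate_append_replicate, Nat.mul_succ, Nat.add_comm]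
    rw [← this]
    simp
  rw [h1] at h
  exact h.mono (by simp [goalTime, length_zeros]; omega)

/-- Write the initial state, consuming the input and the counter `e`. -/
def startProg : Prog (Alph α) :=
  .seq (.loop .e fun _ => emit (zeros S.width)) (.seq (emit S.mark)
    (.seq (.loop .inp fun x => emit (S.cell x)) (emit S.start)))

/-- The first input symbol is the top of the input stack and belongs into the highest block; since
writing goes backwards, it is rightly written first. This is the origin of the reversal. -/
theorem startProg_does :
    Does S.startProg (regs i r o n e t u a b)
      (regs [] r (S.start ++ (i.reverse.flatMap S.cell ++ (S.mark ++ zeros (S.width * e))) ++ o)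
        n 0 t u a b)
      (e * (S.width + 2) + i.length * (S.width + 2) + (S.mark.length + S.start.length + 4)) := by
  have key1 : ∀ e o, Does (.loop .e fun _ => emit (zeros S.width)) (regs i r o n e t u a b)
      (regs i r (zeros (S.width * e) ++ o) n 0 t u a b) (e * (S.width + 2) + 1) := by
    intro e
    induction e with
    | zero => intro o; exact .mono (.loop_nil rfl) (by omega)
    | succ e ih =>
      intro o
      have h := ih (zeros S.width ++ o)
      rw [← List.append_assoc, ← zeros_mul_succ] at h
      refine (Does.loop_cons (x := ()) (s₁ := regs i r o n e t u a b) rfl ?_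
        (emit_does _) h).mono (by rw [length_zeros]; ring_nf; omega)
      intro j hj; cases j <;> first | rfl | exact absurd rfl hj
  have key2 : ∀ (i : List α) o, Does (.loop .inp fun x => emit (S.cell x))
      (regs i r o n 0 t u a b) (regs [] r (i.reverse.flatMap S.cell ++ o) n 0 t u a b)
      (i.length * (S.width + 2) + 1) := by
    intro i
    induction i with
    | nil => intro o; exact .mono (.loop_nil rfl) (by simp)
    | cons x i ih =>
      intro o
      have h := ih (S.cell x ++ o)
      rw [show i.reverse.flatMap S.cell ++ (S.cell x ++ o) =
        (x :: i).reverse.flatMap S.cell ++ o by simp] at h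
      refine (Does.loop_cons (x := x) (s₁ := regs i r o n 0 t u a b) rfl ?_
        (emit_does _) h).mono (by rw [S.length_cell, List.length_cons]; ring_nf; omega)
      intro j hj; cases j <;> first | rfl | exact absurd rfl hj
  have h := (key1 e o).seq ((emit_does S.mark).seq ((key2 i _).seq (emit_does S.start)))
  simp only [← List.append_assoc] at h ⊢
  exact h.mono (by omega)

/-- Empty the counters `n` and `a`. -/
def clear : Prog (Alph α) :=
  .seq (.loop .n fun _ => .skip) (.loop .a fun _ => .skip)

theorem clear_does :
    Does clear (regs i r o n e t u a b) (regs i r o 0 e t u 0 b) (2 * n + 2 * a + 2) := by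
  have key1 : ∀ n, Does (.loop .n fun _ => .skip) (regs i r o n e t u a b)
      (regs i r o 0 e t u a b) (2 * n + 1) := by
    intro n
    induction n with
    | zero => exact .loop_nil rfl
    | succ n ih =>
      refine (Does.loop_cons (x := ()) (s₁ := regs i r o n e t u a b) rfl ?_
        .skip ih).mono (by omega)
      intro j hj; cases j <;> first | rfl | exact absurd rfl hj
  have key2 : ∀ a, Does (.loop .a fun _ => .skip) (regs i r o 0 e t u a b)
      (regs i r o 0 e t u 0 b) (2 * a + 1) := by
    intro a
    induction a with
    | zero => exact .loop_nil rfl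
    | succ a ih =>
      refine (Does.loop_cons (x := ()) (s₁ := regs i r o 0 e t u a b) rfl ?_
        .skip ih).mono (by omega)
      intro j hj; cases j <;> first | rfl | exact absurd rfl hj
  exact ((key1 n).seq (key2 a)).mono (by omega)

/-- The program that writes the output. -/
def prog : Prog (Alph α) :=
  .seq measure (.seq (power S.offset S.degree) (.seq bound
    (.seq (emit [Γ'.comma, Γ'.comma, Γ'.comma]) (.seq (actionsProg S.width S.templates)
      (.seq S.goalProg (.seq S.goalProg (.seq S.goalProg (.seq (emit [Γ'.comma])
        (.seq S.startProg clear)))))))))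

/-- The time taken by the program on inputs of length `n`. -/
def time (n : ℕ) : ℕ :=
  5 * n + 2 + powerTime S.offset n S.degree + (5 * n + 5 * S.slack n + 6) + 4 +
    (S.places n * (templatesTime S.width (n + S.slack n + 1) S.templates + 2) + 1) +
    3 * S.goalTime (S.places n) + 2 +
    (S.slack n * (S.width + 2) + n * (S.width + 2) + (S.mark.length + S.start.length + 4)) +
    (2 * n + 2 * S.places n + 2)

theorem prog_does (w : List α) :
    Does S.prog (regs w [] [] 0 0 0 0 0 0) (regs [] [] (S.output w) 0 0 0 0 0 0)
      (S.time w.length) := by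
  have h := (measure_does (i := w) (o := []) (e := 0) (t := 0) (u := 0) (a := 0) (b := 0)).seq
    ((power_does (c := S.offset) (d := S.degree)).seq (bound_does.seq
      ((emit_does [Γ'.comma, Γ'.comma, Γ'.comma]).seq
        ((actionsProg_does (c := S.width) S.templates
            (m := w.length + (w.length + S.offset) ^ S.degree + 1) (by omega)).seq
          (S.goalProg_does.seq (S.goalProg_does.seq (S.goalProg_does.seq
            ((emit_does [Γ'.comma]).seq (S.startProg_does.seq clear_does)))))))))
  have e1 : S.places w.length - 1 = w.length + (w.length + S.offset) ^ S.degree + 1 := rfl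
  have e2 : S.places w.length = w.length + (w.length + S.offset) ^ S.degree + 1 + 1 := rfl
  have e3 : S.slack w.length = (w.length + S.offset) ^ S.degree := rfl
  rw [output, startStr, goalStr, e1, e2, e3]
  simp only [List.append_assoc, List.append_nil] at h ⊢
  refine h.mono ?_
  rw [time, e2, e3]
  simp only [List.length_cons, List.length_nil, show ∀ x : ℕ, x + 1 + 1 = x + 2 from fun _ => rfl]
  omega

end Blueprint

end Emitter

namespace Emitter

open Computability StackProgram

variable {α : Type}

/-! ### Polynomial time -/

/-- The function `f` is given by a polynomial. -/
def IsPoly (f : ℕ → ℕ) : Prop := ∃ q : Polynomial ℕ, ∀ n, q.eval n = f n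

theorem IsPoly.const (c : ℕ) : IsPoly fun _ => c := ⟨.C c, by simp⟩

theorem IsPoly.id : IsPoly fun n => n := ⟨.X, by simp⟩

theorem IsPoly.add {f g : ℕ → ℕ} : IsPoly f → IsPoly g → IsPoly fun n => f n + g n
  | ⟨p, hp⟩, ⟨q, hq⟩ => ⟨p + q, by simp [hp, hq]⟩

theorem IsPoly.mul {f g : ℕ → ℕ} : IsPoly f → IsPoly g → IsPoly fun n => f n * g n
  | ⟨p, hp⟩, ⟨q, hq⟩ => ⟨p * q, by simp [hp, hq]⟩

theorem IsPoly.pow {f : ℕ → ℕ} (d : ℕ) : IsPoly f → IsPoly fun n => f n ^ d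
  | ⟨p, hp⟩ => ⟨p ^ d, by simp [hp]⟩

/-- The exponent is a constant of the reduction, so the recursion unfolds to a fixed number of
polynomial terms. -/
theorem isPoly_powerTime (c d : ℕ) : IsPoly fun n => powerTime c n d := by
  induction d with
  | zero => exact .const 1
  | succ d ih =>
    exact ih.add ((((IsPoly.id.add (.const c)).pow d).mul
      (((IsPoly.const c).add ((IsPoly.const 5).mul .id)).add (.const 6))).add (.const 2))

theorem IsPoly.patternTime {f : ℕ → ℕ} (hf : IsPoly f) (c : ℕ) (P : Pattern) :
    IsPoly fun n => P.time c (f n) :=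
  (hf.mul (.const _)).add (.const _)

theorem IsPoly.templatesTime {f : ℕ → ℕ} (hf : IsPoly f) (c : ℕ) (l : List Template) :
    IsPoly fun n => templatesTime c (f n) l := by
  induction l with
  | nil => exact .const 1
  | cons τ l ih =>
    exact ih.add ((((hf.patternTime c _).add (hf.patternTime c _)).add
      (hf.patternTime c _)).add (.const 8))

namespace Blueprint

variable (S : Blueprint α)

theorem isPoly_slack : IsPoly S.slack := (IsPoly.id.add (.const _)).pow _

theorem isPoly_places : IsPoly S.places := (IsPoly.id.add S.isPoly_slack).add (.const _)

theorem isPoly_goalTime : IsPoly fun n => S.goalTime (S.places n) :=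
  (S.isPoly_places.mul (.const _)).add (.const _)

theorem isPoly_time : IsPoly S.time := by
  refine IsPoly.add (.add (.add (.add (.add (.add (.add (.add ?_ ?_) ?_) ?_) ?_) ?_) ?_) ?_) ?_
  · exact ((IsPoly.const _).mul .id).add (.const _)
  · exact isPoly_powerTime _ _
  · exact (((IsPoly.const _).mul .id).add ((IsPoly.const _).mul S.isPoly_slack)).add (.const _)
  · exact .const _
  · exact (S.isPoly_places.mul ((IsPoly.templatesTime
      ((IsPoly.id.add S.isPoly_slack).add (.const 1)) _ _).add (.const _))).add (.const _)
  · exact (IsPoly.const _).mul S.isPoly_goalTime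
  · exact .const _
  · exact ((S.isPoly_slack.mul (.const _)).add (IsPoly.id.mul (.const _))).add (.const _)
  · exact (((IsPoly.const _).mul .id).add ((IsPoly.const _).mul S.isPoly_places)).add (.const _)

/-- A function whose values are written by an emitter is computable in polynomial time. -/
theorem computableInPolyTime [Finite α] {β : Type} (enc : β → List Γ') (f : List α → β)
    (hf : ∀ w, enc (f w) = S.output w) :
    Nonempty (Turing.TM2ComputableInPolyTime (id : List α → List α) enc f) := by
  obtain ⟨q, hq⟩ := S.isPoly_time
  have h : ∀ w : List α, Nonempty (Turing.TM2OutputsInTime (machine S.prog .inp .out) w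
      (some (S.output w)) ((q + 1).eval w.length)) := by
    intro w
    have h1 : regs w [] [] 0 0 0 0 0 0 = onlyStack (Γ := Alph α) .inp w := by
      funext j; cases j <;> rfl
    have h2 : regs [] [] (S.output w) 0 0 0 0 0 0 = onlyStack (Γ := Alph α) .out (S.output w) := by
      funext j; cases j <;> rfl
    have h := S.prog_does w
    rw [h1, h2, ← hq] at h
    have h3 := machine_outputs h
    rwa [← Polynomial.eval_one (x := w.length), ← Polynomial.eval_add] at h3
  refine ⟨{ tm := machine S.prog .inp .out, inputAlphabet := Equiv.refl α,
            outputAlphabet := Equiv.refl Γ', time := q + 1, outputsFun := fun w => ?_ }⟩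
  have e1 : List.map (Equiv.refl α).invFun (id w) = w := List.map_id _
  have e2 : List.map (Equiv.refl Γ').invFun (enc (f w)) = S.output w := by
    rw [hf]; exact List.map_id _
  -- The run is data whose type mentions the two strings, so it is transported along their
  -- equalities.
  exact cast (congrArg₂ (fun (l : List α) (o : List Γ') => Turing.TM2OutputsInTime
    (machine S.prog .inp .out) l (some o) ((q + 1).eval w.length)) e1.symm e2.symm) (h w).some

end Blueprint

end Emitter

/-! ## Planning problems that simulate stack machines -/

namespace StackPlanning

open Computability

variable {K : Type} {A : K → Type} {Q : Type}

/-! ### Sets of fluents that are organized in blocks -/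

/-- The fluents of a block: "the top of the stack `k` is below here", and "here is this symbol of
this stack". -/
abbrev BlockFluent (A : K → Type) : Type := K ⊕ Σ k, A k

/-- Global fluents, and the fluents of the blocks `0, 1, …` -/
abbrev Fluent (Q : Type) (A : K → Type) : Type := Q ⊕ ℕ × BlockFluent A

/-- A numbering of the global fluents and of the fluents of a block. -/
structure Layout (Q : Type) (A : K → Type) where
  numGlobal : ℕ
  width : ℕ
  globalEquiv : Q ≃ Fin numGlobal
  blockEquiv : BlockFluent A ≃ Fin width

namespace Layout

variable (Y : Layout Q A) (S : ℕ)

/-- The number of fluents if there are `S` blocks. -/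
abbrev size : ℕ := Y.numGlobal + S * Y.width

/-- The fluent with a given number. -/
def decode (i : Fin (Y.size S)) : Fluent Q A :=
  (finSumFinEquiv.symm i).map Y.globalEquiv.symm fun j =>
    ((finProdFinEquiv.symm j).1, Y.blockEquiv.symm (finProdFinEquiv.symm j).2)

theorem exists_decode_inl (q : Q) : ∃ i, Y.decode S i = .inl q :=
  ⟨finSumFinEquiv (.inl (Y.globalEquiv q)), by simp [decode]⟩

theorem exists_decode_inr {k : ℕ} (hk : k < S) (b : BlockFluent A) :
    ∃ i, Y.decode S i = .inr (k, b) :=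
  ⟨finSumFinEquiv (.inr (finProdFinEquiv (⟨k, hk⟩, Y.blockEquiv b))), by
    simp only [decode, Equiv.symm_apply_apply, Sum.map_inr]⟩

open Classical in
/-- The set of the fluents that satisfy `p`. -/
noncomputable def toSet (p : Fluent Q A → Prop) : Finset (Fin (Y.size S)) :=
  Finset.univ.filter fun i => p (Y.decode S i)

theorem mem_toSet {p : Fluent Q A → Prop} {i} : i ∈ Y.toSet S p ↔ p (Y.decode S i) := by
  simp [toSet]

open Classical in
/-- The bits of a set of global fluents. -/
noncomputable def globalStr (p : Q → Prop) : List Γ' :=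
  List.ofFn fun i => Γ'.bit (decide (p (Y.globalEquiv.symm i)))

open Classical in
/-- The bits of a set of fluents of a block. -/
noncomputable def blockStr (p : BlockFluent A → Prop) : List Γ' :=
  List.ofFn fun i => Γ'.bit (decide (p (Y.blockEquiv.symm i)))

theorem length_blockStr (p : BlockFluent A → Prop) : (Y.blockStr p).length = Y.width := by
  simp [blockStr]

theorem blockStr_false : Y.blockStr (fun _ => False) = Emitter.zeros Y.width := by
  simp [blockStr, Emitter.zeros]

/-- The numbering puts the global fluents first and then the blocks in order, so the bit vector
splits along `Fin` sums and products. -/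
theorem encodeSet_toSet (p : Fluent Q A → Prop) :
    HAGLInstance.encodeSet (Y.toSet S p) = Y.globalStr (fun q => p (.inl q)) ++
      (List.range S).flatMap fun k => Y.blockStr fun b => p (.inr (k, b)) := by
  classical
  have h1 : HAGLInstance.encodeSet (Y.toSet S p) =
      List.ofFn fun i => Γ'.bit (decide (p (Y.decode S i))) := by
    rw [HAGLInstance.encodeSet, List.map_ofFn]
    congr 1
    funext i
    simp only [Function.comp_apply, mem_toSet]
  rw [h1, List.ofFn_add, List.ofFn_mul]
  congr 1
  · rw [globalStr]
    congr 1
    funext i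
    have : Y.decode S (Fin.castAdd _ i) = .inl (Y.globalEquiv.symm i) := by simp [decode]
    change Γ'.bit (decide (p (Y.decode S (Fin.castAdd _ i)))) = _
    rw [this]
  · rw [List.flatMap, ← List.map_coe_finRange_eq_range, List.map_map, ← List.ofFn_eq_map]
    congr 2
    funext k
    rw [Function.comp_apply, blockStr]
    congr 1
    funext i
    have : Y.decode S (Fin.natAdd _ ⟨k * Y.width + i, by
        calc k * Y.width + i < k * Y.width + Y.width := by omega
          _ = (k + 1) * Y.width := by ring
          _ ≤ S * Y.width := Nat.mul_le_mul_right _ k.2⟩) =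
        .inr (k, Y.blockEquiv.symm i) := by
      have h2 : (⟨k * Y.width + i, by
        calc k * Y.width + i < k * Y.width + Y.width := by omega
          _ = (k + 1) * Y.width := by ring
          _ ≤ S * Y.width := Nat.mul_le_mul_right _ k.2⟩ : Fin (S * Y.width)) =
          finProdFinEquiv (k, i) := by
        ext
        simp [finProdFinEquiv]
        ring
      simp only [decode, finSumFinEquiv_symm_apply_natAdd, Sum.map_inr, h2,
        Equiv.symm_apply_apply]
    rw [this]

theorem flatMap_blockStr_false {f : ℕ → ℕ} (n : ℕ) {p : ℕ → BlockFluent A → Prop}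
    (h : ∀ k < n, ∀ b, ¬ p (f k) b) :
    ((List.range n).flatMap fun k => Y.blockStr (p (f k))) = Emitter.zeros (Y.width * n) := by
  induction n with
  | zero => rfl
  | succ n ih =>
    have h1 : p (f n) = fun _ => False := by
      funext b
      simpa using h n (by omega) b
    rw [List.range_succ, List.flatMap_append, ih fun k hk => h k (by omega),
      List.flatMap_singleton, h1, blockStr_false, Emitter.zeros_mul_succ]

/-- A set of global fluents and of fluents of two consecutive blocks, placed at the block `h`. -/
def place (h : ℕ) (p : Q ⊕ Bool × BlockFluent A → Prop) : Fluent Q A → Prop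
  | .inl q => p (.inl q)
  | .inr (i, b) => (i = h ∧ p (.inr (false, b))) ∨ (i = h + 1 ∧ p (.inr (true, b)))

/-- The bits of a set of global fluents and of fluents of two consecutive blocks. -/
noncomputable def pattern (p : Q ⊕ Bool × BlockFluent A → Prop) : Emitter.Pattern where
  glob := Y.globalStr fun q => p (.inl q)
  win := (Y.blockStr fun b => p (.inr (false, b))) ++ Y.blockStr fun b => p (.inr (true, b))

theorem encodeSet_place (p : Q ⊕ Bool × BlockFluent A → Prop) {lo hi : ℕ}
    (hS : S = lo + 2 + hi) :
    HAGLInstance.encodeSet (Y.toSet S (place lo p)) = (Y.pattern p).str Y.width lo hi := by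
  subst hS
  rw [encodeSet_toSet, Emitter.Pattern.str, pattern, List.append_assoc, List.append_assoc]
  congr 1
  rw [List.range_add, List.range_add, List.flatMap_append, List.flatMap_append,
    List.append_assoc, List.flatMap_map, List.flatMap_map]
  congr 1
  · refine Y.flatMap_blockStr_false (f := fun k => k)
      (p := fun k b => place lo p (.inr (k, b))) lo ?_
    intro k hk b
    simp only [place]
    omega
  congr 1
  · have e1 : (fun b => place lo p (.inr (lo + 0, b))) = fun b => p (.inr (false, b)) := by
      funext b
      simp [place]
    have e2 : (fun b => place lo p (.inr (lo + 1, b))) = fun b => p (.inr (true, b)) := by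
      funext b
      simp [place]
    simp only [show List.range 2 = [0, 1] from rfl, List.flatMap_cons, List.flatMap_nil, e1, e2,
      List.append_nil]
  · refine Y.flatMap_blockStr_false (f := fun k => lo + 2 + k)
      (p := fun k b => place lo p (.inr (k, b))) hi ?_
    intro k hk b
    simp only [place]
    omega

end Layout

/-! ### Machines with several stacks -/

/-- The operations: push a symbol on a stack, pop it, or test that it is on the top. -/
inductive Op (A : K → Type)
  | push (a : Σ k, A k)
  | pop (a : Σ k, A k)
  | keep (a : Σ k, A k)

instance [Finite K] [∀ k, Finite (A k)] : Finite (Op A) := by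
  refine Finite.of_injective (β := (Σ k, A k) ⊕ (Σ k, A k) ⊕ (Σ k, A k))
    (fun o => match o with
      | .push a => .inl a
      | .pop a => .inr (.inl a)
      | .keep a => .inr (.inr a)) ?_
  rintro (a | a | a) (b | b | b) h <;> simp_all

/-- The fluents that hold in a configuration. -/
def State (q : Q) (c : ∀ k, List (A k)) : Fluent Q A → Prop
  | .inl q' => q' = q
  | .inr (i, .inl k) => i = (c k).length
  | .inr (i, .inr ⟨k, a⟩) => (c k).reverse[i]? = some a

/-- The preconditions of a rule, which goes from one control state to another and performs an
operation. -/
def prePattern : Q × Q × Op A → Q ⊕ Bool × BlockFluent A → Prop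
  | (q, _, .push a), x => x = .inl q ∨ x = .inr (false, .inl a.1)
  | (q, _, .pop a), x => x = .inl q ∨ x = .inr (true, .inl a.1) ∨ x = .inr (false, .inr a)
  | (q, _, .keep a), x => x = .inl q ∨ x = .inr (true, .inl a.1) ∨ x = .inr (false, .inr a)

/-- The add effects of a rule. -/
def addPattern : Q × Q × Op A → Q ⊕ Bool × BlockFluent A → Prop
  | (_, q', .push a), x => x = .inl q' ∨ x = .inr (true, .inl a.1) ∨ x = .inr (false, .inr a)
  | (_, q', .pop a), x => x = .inl q' ∨ x = .inr (false, .inl a.1)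
  | (_, q', .keep _), x => x = .inl q'

/-- The delete effects of a rule. -/
def delPattern : Q × Q × Op A → Q ⊕ Bool × BlockFluent A → Prop
  | (q, _, .push a), x => x = .inl q ∨ x = .inr (false, .inl a.1)
  | (q, _, .pop a), x => x = .inl q ∨ x = .inr (true, .inl a.1) ∨ x = .inr (false, .inr a)
  | (q, _, .keep _), x => x = .inl q

/-- Counted from the bottom, the old symbols keep their positions under a push; only one fact is
added. This keeps the effects of actions local. -/
theorem getElem?_reverse_cons {X : Type} (x : X) (l : List X) (i : ℕ) (y : X) :
    (x :: l).reverse[i]? = some y ↔ l.reverse[i]? = some y ∨ (i = l.length ∧ y = x) := by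
  rw [List.reverse_cons, List.getElem?_append]
  split
  · rename_i h
    rw [List.length_reverse] at h
    constructor
    · exact Or.inl
    · rintro (h1 | ⟨h1, -⟩)
      · exact h1
      · omega
  · rename_i h
    rw [List.length_reverse] at h
    have h1 : l.reverse[i]? = none := by simpa using h
    rw [h1, List.length_reverse]
    rcases Nat.eq_or_lt_of_le (not_lt.1 h) with h2 | h2
    · subst h2
      simp [eq_comm]
    · have : i - l.length ≠ 0 := by omega
      have h3 : i ≠ l.length := by omega
      simp [this, h3]

theorem eq_cons_of_getElem?_reverse {X : Type} {l : List X} {h : ℕ} {x : X}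
    (h1 : h + 1 = l.length) (h2 : l.reverse[h]? = some x) : ∃ l', l = x :: l' := by
  cases l with
  | nil => simp at h1
  | cons y l =>
    rw [getElem?_reverse_cons] at h2
    rcases h2 with h2 | ⟨-, rfl⟩
    · have := (List.getElem?_eq_some_iff.1 h2).1
      simp at this h1
      omega
    · exact ⟨l, rfl⟩

/-- Applying the effects of a rule to the fluents of a configuration. -/
theorem state_apply_keep (q q' : Q) (c : ∀ k, List (A k)) (a : Σ k, A k) (h : ℕ)
    (x : Fluent Q A) :
    (State q c x ∧ ¬ Layout.place h (delPattern (q, q', .keep a)) x) ∨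
        Layout.place h (addPattern (q, q', .keep a)) x ↔ State q' c x := by
  rcases x with y | ⟨i, j | ⟨j, b⟩⟩ <;> simp [State, Layout.place, delPattern, addPattern]

variable [DecidableEq K]

/-- The effect of an operation. -/
inductive OpStep : Op A → (∀ k, List (A k)) → (∀ k, List (A k)) → Prop
  | push (k : K) (a : A k) (c) : OpStep (.push ⟨k, a⟩) c (Function.update c k (a :: c k))
  | pop (k : K) (a : A k) (c) (l) (h : c k = a :: l) :
      OpStep (.pop ⟨k, a⟩) c (Function.update c k l)
  | keep (k : K) (a : A k) (c) (l) (h : c k = a :: l) : OpStep (.keep ⟨k, a⟩) c c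

theorem OpStep.unique {o : Op A} {c c' c'' : ∀ k, List (A k)} (h : OpStep o c c')
    (h' : OpStep o c c'') : c' = c'' := by
  cases h with
  | push => cases h'; rfl
  | pop k a c l h =>
    cases h' with
    | pop _ _ _ l' h' => rw [h] at h'; cases h'; rfl
  | keep => cases h'; rfl

theorem state_apply_push (q q' : Q) (c : ∀ k, List (A k)) (k : K) (a : A k) (x : Fluent Q A) :
    (State q c x ∧ ¬ Layout.place (c k).length (delPattern (q, q', .push ⟨k, a⟩)) x) ∨
        Layout.place (c k).length (addPattern (q, q', .push ⟨k, a⟩)) x ↔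
      State q' (Function.update c k (a :: c k)) x := by
  rcases x with y | ⟨i, j | ⟨j, b⟩⟩
  · simp [State, Layout.place, delPattern, addPattern]
  · by_cases hj : j = k
    · subst hj
      simp [State, Layout.place, delPattern, addPattern]
    · simp [State, Layout.place, delPattern, addPattern, hj]
  · by_cases hj : j = k
    · subst hj
      simp only [State, Layout.place, delPattern, addPattern, Function.update_self,
        getElem?_reverse_cons]
      simp
    · simp [State, Layout.place, delPattern, addPattern, hj]

theorem state_apply_pop (q q' : Q) (c : ∀ k, List (A k)) (k : K) (a : A k) (l : List (A k))
    (hl : c k = a :: l) (x : Fluent Q A) :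
    (State q c x ∧ ¬ Layout.place l.length (delPattern (q, q', .pop ⟨k, a⟩)) x) ∨
        Layout.place l.length (addPattern (q, q', .pop ⟨k, a⟩)) x ↔
      State q' (Function.update c k l) x := by
  rcases x with y | ⟨i, j | ⟨j, b⟩⟩
  · simp [State, Layout.place, delPattern, addPattern]
  · by_cases hj : j = k
    · subst hj
      simp [State, Layout.place, delPattern, addPattern, hl]
    · simp [State, Layout.place, delPattern, addPattern, hj]
  · by_cases hj : j = k
    · subst hj
      simp only [State, Layout.place, delPattern, addPattern, Function.update_self, hl,
        getElem?_reverse_cons]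
      -- Nothing that stays on the stack sits at the height of the popped symbol, so its deletion
      -- loses no other symbol.
      have : l.reverse[i]? = some b → i ≠ l.length := by
        intro h
        have := (List.getElem?_eq_some_iff.1 h).1
        rw [List.length_reverse] at this
        omega
      simp
      tauto
    · simp [State, Layout.place, delPattern, addPattern, hj]

end StackPlanning

namespace StackPlanning

open Computability

variable {K : Type} {A : K → Type} {Q : Type}

/-! ### The planning domain of a machine -/

namespace Layout

variable (Y : Layout Q A)

theorem toSet_apply (S : ℕ) {s d a t : Fluent Q A → Prop}
    (h : ∀ x, (s x ∧ ¬ d x) ∨ a x ↔ t x) :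
    (Y.toSet S s \ Y.toSet S d) ∪ Y.toSet S a = Y.toSet S t := by
  ext i
  simp only [Finset.mem_union, Finset.mem_sdiff, mem_toSet]
  exact h _

theorem toSet_mono (S : ℕ) {s t : Fluent Q A → Prop} (h : ∀ x, s x → t x) :
    Y.toSet S s ⊆ Y.toSet S t := by
  intro i
  simp only [mem_toSet]
  exact h _

theorem of_toSet_subset_inl {S : ℕ} {s t : Fluent Q A → Prop} (h : Y.toSet S s ⊆ Y.toSet S t)
    {q : Q} (hq : s (.inl q)) : t (.inl q) := by
  obtain ⟨i, hi⟩ := Y.exists_decode_inl S q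
  have := @h i
  simp only [mem_toSet, hi] at this
  exact this hq

theorem of_toSet_subset_inr {S : ℕ} {s t : Fluent Q A → Prop} (h : Y.toSet S s ⊆ Y.toSet S t)
    {k : ℕ} (hk : k < S) {b : BlockFluent A} (hb : s (.inr (k, b))) : t (.inr (k, b)) := by
  obtain ⟨i, hi⟩ := Y.exists_decode_inr S hk b
  have := @h i
  simp only [mem_toSet, hi] at this
  exact this hb

/-- The action that applies a rule at the blocks `h` and `h + 1`. -/
noncomputable def action (S : ℕ) (r : Q × Q × Op A) (h : ℕ) : PlanAction (Fin (Y.size S)) where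
  pre := Y.toSet S (place h (prePattern r))
  add := Y.toSet S (place h (addPattern r))
  del := Y.toSet S (place h (delPattern r))

/-- The domain whose actions apply the rules at all blocks. -/
noncomputable def domain (rules : List (Q × Q × Op A)) (R : ℕ) :
    PlanDomain (Fin (Y.size (R + 1))) where
  actions := (List.range R).flatMap fun h => rules.map fun r => Y.action (R + 1) r h

/-- The template of the actions that apply a rule. -/
noncomputable def template (r : Q × Q × Op A) : Emitter.Template where
  pre := Y.pattern (prePattern r)
  add := Y.pattern (addPattern r)
  del := Y.pattern (delPattern r)

theorem encodeActions_domain (rules : List (Q × Q × Op A)) (R : ℕ) :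
    HAGLInstance.encodeActions (Y.domain rules R).actions =
      Emitter.actionsStr Y.width (rules.map Y.template) (R - 1) R := by
  rw [HAGLInstance.encodeActions, domain, Emitter.actionsStr, List.flatMap_assoc]
  refine List.flatMap_congr fun h hh => ?_
  rw [List.flatMap_map, List.flatMap_map]
  refine List.flatMap_congr fun r _ => ?_
  have hS : R + 1 = h + 2 + (R - 1 - h) := by
    have := List.mem_range.1 hh
    omega
  simp only [HAGLInstance.encodeAction, action, Emitter.Template.str, template,
    Y.encodeSet_place _ _ hS]

theorem encodeSet_singleton (S : ℕ) (q : Q) :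
    HAGLInstance.encodeSet (Y.toSet S (· = .inl q)) =
      Y.globalStr (· = q) ++ Emitter.zeros (Y.width * S) := by
  rw [Y.encodeSet_toSet]
  congr 1
  · congr 1
    funext q'
    simp
  · exact Y.flatMap_blockStr_false (f := fun i => i) (p := fun i b => .inr (i, b) = Sum.inl q) S
      (by simp)

end Layout

variable [DecidableEq K] (Y : Layout Q A)

/-- A step of the machine with the given rules. -/
def RuleStep (rules : List (Q × Q × Op A)) (x y : Q × ∀ k, List (A k)) : Prop :=
  ∃ o, (x.1, y.1, o) ∈ rules ∧ OpStep o x.2 y.2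

/-- The precondition pins down the control state, and its marker and symbol pin down height and top
of the stack. With `h < R` both blocks of the action are among the `R + 1` existing ones, so no
condition has been cut off by `toSet`. -/
theorem exists_opStep_of_pre_subset {R h : ℕ} (hR : h < R) {p p' q : Q} {o : Op A}
    {c : ∀ k, List (A k)}
    (hs : (Y.action (R + 1) (p, p', o) h).pre ⊆ Y.toSet (R + 1) (State q c)) :
    p = q ∧ ∃ c', OpStep o c c' ∧
      (Y.toSet (R + 1) (State q c) \ (Y.action (R + 1) (p, p', o) h).del) ∪
        (Y.action (R + 1) (p, p', o) h).add = Y.toSet (R + 1) (State p' c') := by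
  have hq : p = q := by
    refine Y.of_toSet_subset_inl hs ?_
    cases o <;> simp [Layout.place, prePattern]
  subst hq
  refine ⟨rfl, ?_⟩
  rcases o with ⟨k, a⟩ | ⟨k, a⟩ | ⟨k, a⟩
  · have h1 : h = (c k).length := Y.of_toSet_subset_inr hs (k := h) (b := .inl k) (by omega)
      (by simp [Layout.place, prePattern])
    subst h1
    exact ⟨_, .push k a c, Y.toSet_apply _ (state_apply_push p p' c k a)⟩
  · have h1 : h + 1 = (c k).length := Y.of_toSet_subset_inr hs (k := h + 1) (b := .inl k)
      (by omega) (by simp [Layout.place, prePattern])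
    have h2 : (c k).reverse[h]? = some a := Y.of_toSet_subset_inr hs (k := h)
      (b := .inr ⟨k, a⟩) (by omega) (by simp [Layout.place, prePattern])
    obtain ⟨l, hl⟩ := eq_cons_of_getElem?_reverse h1 h2
    obtain rfl : h = l.length := by simpa [hl] using h1
    exact ⟨_, .pop k a c l hl, Y.toSet_apply _ (state_apply_pop p p' c k a l hl)⟩
  · have h1 : h + 1 = (c k).length := Y.of_toSet_subset_inr hs (k := h + 1) (b := .inl k)
      (by omega) (by simp [Layout.place, prePattern])
    have h2 : (c k).reverse[h]? = some a := Y.of_toSet_subset_inr hs (k := h)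
      (b := .inr ⟨k, a⟩) (by omega) (by simp [Layout.place, prePattern])
    obtain ⟨l, hl⟩ := eq_cons_of_getElem?_reverse h1 h2
    exact ⟨_, .keep k a c l hl, Y.toSet_apply _ (state_apply_keep p p' c _ h)⟩

/-- A push is placed at the current height, a pop or a test one block lower; below height `R` these
places exist. -/
theorem exists_pre_subset_of_opStep {R : ℕ} {q q' : Q} {o : Op A} {c c' : ∀ k, List (A k)}
    (ho : OpStep o c c') (hc : ∀ k, (c k).length < R) :
    ∃ h < R, (Y.action (R + 1) (q, q', o) h).pre ⊆ Y.toSet (R + 1) (State q c) := by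
  cases ho with
  | push k a =>
    refine ⟨_, hc k, Y.toSet_mono _ ?_⟩
    rintro (y | ⟨i, j | ⟨j, b⟩⟩)
    · simp [Layout.place, prePattern, State]
    · simp only [Layout.place, prePattern, State]
      simp
      rintro rfl rfl
      rfl
    · simp [Layout.place, prePattern]
  | pop k a _ l hl =>
    have h1 : l.length < R := by
      have := hc k
      rw [hl, List.length_cons] at this
      omega
    refine ⟨_, h1, Y.toSet_mono _ ?_⟩
    rintro (y | ⟨i, j | ⟨j, b⟩⟩)
    · simp [Layout.place, prePattern, State]
    · simp only [Layout.place, prePattern, State]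
      simp
      rintro rfl rfl
      simp [hl]
    · simp only [Layout.place, prePattern, State]
      simp
      rintro rfl rfl h
      cases h
      simp [hl]
  | keep k a _ l hl =>
    have h1 : l.length < R := by
      have := hc k
      rw [hl, List.length_cons] at this
      omega
    refine ⟨_, h1, Y.toSet_mono _ ?_⟩
    rintro (y | ⟨i, j | ⟨j, b⟩⟩)
    · simp [Layout.place, prePattern, State]
    · simp only [Layout.place, prePattern, State]
      simp
      rintro rfl rfl
      simp [hl]
    · simp only [Layout.place, prePattern, State]
      simp
      rintro rfl rfl h
      cases h
      simp [hl]

/-! ### Plans of the domain and computations of the machine -/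

open Relation

variable {Y} {rules : List (Q × Q × Op A)} {R : ℕ}

/-- No space hypothesis is needed: an action that would exceed the available blocks does not exist.
-/
theorem exec_sound (π : List (PlanAction (Fin (Y.size (R + 1))))) (q : Q) (c : ∀ k, List (A k))
    {s} (h : (Y.domain rules R).exec π (Y.toSet (R + 1) (State q c)) = some s) :
    ∃ x, s = Y.toSet (R + 1) (State x.1 x.2) ∧ ReflTransGen (RuleStep rules) (q, c) x := by
  induction π generalizing q c with
  | nil =>
    simp only [PlanDomain.exec, Option.some.injEq] at h
    exact ⟨(q, c), h.symm, .refl⟩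
  | cons a π ih =>
    simp only [PlanDomain.exec, Option.bind_eq_some_iff] at h
    obtain ⟨s1, h1, h2⟩ := h
    rw [PlanDomain.trans] at h1
    split_ifs at h1 with h3
    obtain ⟨ha, hpre⟩ := h3
    simp only [Layout.domain, List.mem_flatMap, List.mem_range, List.mem_map] at ha
    obtain ⟨h, hh, ⟨p, p', o⟩, hr, rfl⟩ := ha
    obtain ⟨rfl, c', ho, e⟩ := exists_opStep_of_pre_subset Y hh hpre
    rw [e, Option.some.injEq] at h1
    subst h1
    obtain ⟨x, hx, hx'⟩ := ih p' c' h2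
    exact ⟨x, hx, .head ⟨o, hr, ho⟩ hx'⟩

theorem exec_complete {x y : Q × ∀ k, List (A k)}
    (h : ReflTransGen (fun x y => RuleStep rules x y ∧ ∀ k, (x.2 k).length < R) x y) :
    ∃ π, (Y.domain rules R).exec π (Y.toSet (R + 1) (State x.1 x.2)) =
      some (Y.toSet (R + 1) (State y.1 y.2)) := by
  induction h using ReflTransGen.head_induction_on with
  | refl => exact ⟨[], rfl⟩
  | head hxz hzy ih =>
    rename_i x z
    obtain ⟨⟨o, hr, ho⟩, hc⟩ := hxz
    obtain ⟨π, hπ⟩ := ih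
    obtain ⟨h, hh, hpre⟩ := exists_pre_subset_of_opStep Y (q := x.1) (q' := z.1) ho hc
    obtain ⟨-, c', ho', e⟩ := exists_opStep_of_pre_subset Y hh hpre
    -- An operation has at most one result, so the action leads to the intended configuration.
    obtain rfl := ho.unique ho'
    refine ⟨Y.action (R + 1) (x.1, z.1, o) h :: π, ?_⟩
    have hmem : Y.action (R + 1) (x.1, z.1, o) h ∈ (Y.domain rules R).actions := by
      simp only [Layout.domain, List.mem_flatMap, List.mem_range, List.mem_map]
      exact ⟨h, hh, _, hr, rfl⟩
    rw [PlanDomain.exec, PlanDomain.trans, if_pos ⟨hmem, hpre⟩, e, Option.bind_some, hπ]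

end StackPlanning

/-! ## Simulating a multi-stack Turing machine -/

namespace TM2Planning

open Computability StackPlanning Turing Relation

variable {K : Type} {Γ : K → Type} {Λ σ : Type} {k₀ k₁ : K}

/-- The rules that execute the statements of a machine one operation at a time. The control state
is the rest of the current statement together with the internal state, or `none` after the machine
has halted with `yes` on top of the stack `k₁`. -/
inductive SimRule (m : Λ → TM2.Stmt Γ Λ σ) (k₀ k₁ : K) (yes : Γ k₁) :
    TM2.Stmt Γ Λ σ → σ → Option (TM2.Stmt Γ Λ σ × σ) → Op (fun k => Option (Γ k)) → Prop
  | push (k f q v) : SimRule m k₀ k₁ yes (.push k f q) v (some (q, v)) (.push ⟨k, some (f v)⟩)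
  | peek (k f q v a) : SimRule m k₀ k₁ yes (.peek k f q) v (some (q, f v a)) (.keep ⟨k, a⟩)
  | pop_some (k f q v x) :
      SimRule m k₀ k₁ yes (.pop k f q) v (some (q, f v (some x))) (.pop ⟨k, some x⟩)
  | pop_none (k f q v) :
      SimRule m k₀ k₁ yes (.pop k f q) v (some (q, f v none)) (.keep ⟨k, none⟩)
  | load (f q v a) : SimRule m k₀ k₁ yes (.load f q) v (some (q, f v)) (.keep ⟨k₀, a⟩)
  | branch (f q q' v a) :
      SimRule m k₀ k₁ yes (.branch f q q') v (some (cond (f v) q q', v)) (.keep ⟨k₀, a⟩)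
  | goto (f v a) : SimRule m k₀ k₁ yes (.goto f) v (some (m (f v), v)) (.keep ⟨k₀, a⟩)
  | halt (v) : SimRule m k₀ k₁ yes .halt v none (.keep ⟨k₁, some yes⟩)

variable {m : Λ → TM2.Stmt Γ Λ σ} {yes : Γ k₁}

/-- The control states of the simulation of a machine. -/
abbrev Control (m : Λ → TM2.Stmt Γ Λ σ) : Type :=
  Option ({q : TM2.Stmt Γ Λ σ // ∃ l, q ∈ TM2.stmts₁ (m l)} × σ)

/-- The statement and the internal state of a control state. -/
def Control.val (d : Control m) : Option (TM2.Stmt Γ Λ σ × σ) := d.map fun x => (x.1.1, x.2)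

/-- Rules lead only to substatements of the machine's statements, so finitely many control states,
and hence finitely many global fluents, suffice. -/
theorem Control.exists_val {q : TM2.Stmt Γ Λ σ} {v : σ} {o d} (hr : SimRule m k₀ k₁ yes q v d o)
    (hq : ∃ l, q ∈ TM2.stmts₁ (m l)) : ∃ d' : Control m, d'.val = d := by
  obtain ⟨l, hl⟩ := hq
  have hsub := TM2.stmts₁_trans hl
  have key : ∀ q' v', q' ∈ TM2.stmts₁ q → ∃ d' : Control m, d'.val = some (q', v') :=
    fun q' v' h => ⟨some (⟨q', l, hsub h⟩, v'), rfl⟩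
  cases hr with
  | push | peek | pop_some | pop_none | load =>
    exact key _ _ (by simp [TM2.stmts₁, TM2.stmts₁_self])
  | branch f q₁ q₂ =>
    refine key _ _ ?_
    cases f v <;> simp [TM2.stmts₁, TM2.stmts₁_self]
  | goto f => exact ⟨some (⟨m (f v), f v, TM2.stmts₁_self⟩, v), rfl⟩
  | halt => exact ⟨none, rfl⟩

instance [Finite Λ] : Finite {q : TM2.Stmt Γ Λ σ // ∃ l, q ∈ TM2.stmts₁ (m l)} := by
  have : {q | ∃ l, q ∈ TM2.stmts₁ (m l)} = ⋃ l, (TM2.stmts₁ (m l) : Set (TM2.Stmt Γ Λ σ)) := by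
    ext
    simp
  have h : {q | ∃ l, q ∈ TM2.stmts₁ (m l)}.Finite := by
    rw [this]
    exact Set.finite_iUnion fun l => Finset.finite_toSet _
  exact h.to_subtype

/-! ### The stacks of the simulation -/

variable [DecidableEq K] {stk : ∀ k, List (Γ k)}

/-- The bottom of a simulated stack. The stack `k₀` has one more symbol there, so that the top of
this stack is initially not in the same block as the top of another stack. -/
def base (k₀ k : K) : List (Option (Γ k)) := if k = k₀ then [none, none] else [none]

/-- The stacks of the simulation. -/
def extend (k₀ : K) (stk : ∀ k, List (Γ k)) (k : K) : List (Option (Γ k)) :=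
  (stk k).map some ++ base k₀ k

theorem length_extend_le (k : K) : (extend k₀ stk k).length ≤ (stk k).length + 2 := by
  rw [extend, List.length_append, List.length_map, base]
  split_ifs <;> simp

theorem extend_ne_nil (k : K) : extend k₀ stk k ≠ [] := by
  rw [extend, base]
  split_ifs <;> simp

/-- The bottom symbol `none` is exactly the value of `head?` on an empty stack, so tops of simulated
stacks are what `peek` and `pop` pass to the machine. -/
theorem head?_of_extend {k : K} {a : Option (Γ k)} {l} (h : extend k₀ stk k = a :: l) :
    (stk k).head? = a := by
  rw [extend] at h
  cases hs : stk k with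
  | nil =>
    rw [hs, base] at h
    split_ifs at h <;> simp_all
  | cons x t => simp_all

theorem extend_eq_cons (k : K) : ∃ l, extend k₀ stk k = (stk k).head? :: l := by
  obtain ⟨a, l, h⟩ := List.exists_cons_of_ne_nil (extend_ne_nil (k₀ := k₀) (stk := stk) k)
  exact ⟨l, by rw [h, head?_of_extend h]⟩

theorem extend_update (k : K) (s : List (Γ k)) :
    extend k₀ (Function.update stk k s) =
      Function.update (extend k₀ stk) k (s.map some ++ base k₀ k) := by
  funext j
  by_cases hj : j = k
  · subst hj; simp [extend]
  · simp [extend, hj]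

theorem extend_push (k : K) (x : Γ k) :
    extend k₀ (Function.update stk k (x :: stk k)) =
      Function.update (extend k₀ stk) k (some x :: extend k₀ stk k) := by
  rw [extend_update]; rfl

theorem extend_pop {k : K} {x : Γ k} {l} (h : extend k₀ stk k = some x :: l) :
    extend k₀ (Function.update stk k (stk k).tail) = Function.update (extend k₀ stk) k l := by
  rw [extend_update]
  congr 1
  have h1 := head?_of_extend h
  cases hs : stk k with
  | nil => simp [hs] at h1
  | cons y t =>
    rw [extend, hs, List.map_cons, List.cons_append] at h
    exact (List.cons.inj h).2

/-- A step of the simulation. -/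
def SimStep (m : Λ → TM2.Stmt Γ Λ σ) (k₀ k₁ : K) (yes : Γ k₁)
    (x y : Option (TM2.Stmt Γ Λ σ × σ) × ∀ k, List (Option (Γ k))) : Prop :=
  ∃ q v o, x.1 = some (q, v) ∧ SimRule m k₀ k₁ yes q v y.1 o ∧ OpStep o x.2 y.2

/-! ### Soundness -/

/-- The configuration of the simulation belongs to a computation from `init`: finishing the current
statement leads to a reachable configuration. -/
def Invariant (m : Λ → TM2.Stmt Γ Λ σ) (k₀ k₁ : K) (yes : Γ k₁) (init : TM2.Cfg Γ Λ σ)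
    (x : Option (TM2.Stmt Γ Λ σ × σ) × ∀ k, List (Option (Γ k))) : Prop :=
  match x.1 with
  | some (q, v) => ∃ stk, x.2 = extend k₀ stk ∧
      StateTransition.Reaches (TM2.step m) init (TM2.stepAux q v stk)
  | none => ∃ v stk, StateTransition.Reaches (TM2.step m) init ⟨none, v, stk⟩ ∧
      (stk k₁).head? = some yes

/-- Within a statement, a rule performs one unfolding of `stepAux`, so the configuration finally
reached is unchanged. -/
theorem Invariant.step {init : TM2.Cfg Γ Λ σ} {x y} (hx : Invariant m k₀ k₁ yes init x)
    (h : SimStep m k₀ k₁ yes x y) : Invariant m k₀ k₁ yes init y := by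
  obtain ⟨d, c⟩ := x
  obtain ⟨d', c'⟩ := y
  obtain ⟨q, v, o, rfl, hr, ho⟩ := h
  obtain ⟨stk, rfl, hreach⟩ := hx
  simp only at hr ho hreach
  cases hr with
  | push k f q =>
    cases ho
    exact ⟨_, (extend_push _ _).symm, hreach⟩
  | peek k f q _ a =>
    cases ho with
    | keep _ _ _ l hl =>
      refine ⟨_, rfl, ?_⟩
      rwa [TM2.stepAux, head?_of_extend hl] at hreach
  | pop_some k f q _ x =>
    cases ho with
    | pop _ _ _ l hl =>
      refine ⟨_, (extend_pop hl).symm, ?_⟩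
      rwa [TM2.stepAux, head?_of_extend hl] at hreach
  | pop_none k f q =>
    cases ho with
    | keep _ _ _ l hl =>
      refine ⟨_, rfl, ?_⟩
      have h1 : stk k = [] := List.head?_eq_none_iff.1 (head?_of_extend hl)
      have h2 : Function.update stk k (stk k).tail = stk := by
        rw [h1, List.tail_nil, ← h1, Function.update_eq_self]
      rwa [TM2.stepAux, head?_of_extend hl, h2] at hreach
  | load f q _ a =>
    cases ho
    exact ⟨_, rfl, hreach⟩
  | branch f q q' _ a =>
    cases ho
    refine ⟨_, rfl, ?_⟩
    rw [TM2.stepAux] at hreach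
    cases h : f v <;> rw [h] at hreach <;> exact hreach
  | goto f _ a =>
    cases ho
    -- Entering the statement of the next label corresponds to one further step of the machine.
    exact ⟨_, rfl, hreach.tail rfl⟩
  | halt =>
    cases ho with
    | keep _ _ _ l hl => exact ⟨v, stk, hreach, head?_of_extend hl⟩

theorem Invariant.steps {init : TM2.Cfg Γ Λ σ} {x y} (hx : Invariant m k₀ k₁ yes init x)
    (h : ReflTransGen (SimStep m k₀ k₁ yes) x y) : Invariant m k₀ k₁ yes init y := by
  induction h with
  | refl => exact hx
  | tail _ h ih => exact ih.step h

/-! ### Completeness -/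

/-- A bound on the number of symbols that a statement pushes. -/
def pushes : TM2.Stmt Γ Λ σ → ℕ
  | .push _ _ q => pushes q + 1
  | .peek _ _ q => pushes q
  | .pop _ _ q => pushes q
  | .load _ q => pushes q
  | .branch _ q q' => pushes q + pushes q'
  | .goto _ => 0
  | .halt => 0

/-- The statement to be executed at a label. -/
def resume (m : Λ → TM2.Stmt Γ Λ σ) : Option Λ → TM2.Stmt Γ Λ σ
  | some l => m l
  | none => .halt

/-- A step of the simulation in less than `R` space. -/
abbrev SpaceStep (m : Λ → TM2.Stmt Γ Λ σ) (k₀ k₁ : K) (yes : Γ k₁) (R : ℕ)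
    (x y : Option (TM2.Stmt Γ Λ σ × σ) × ∀ k, List (Option (Γ k))) : Prop :=
  SimStep m k₀ k₁ yes x y ∧ ∀ k, (x.2 k).length < R

variable {R : ℕ}

theorem head_of_rule {q v d o} {c c' : ∀ k, List (Option (Γ k))} {z}
    (hr : SimRule m k₀ k₁ yes q v d o) (ho : OpStep o c c') (hc : ∀ k, (c k).length < R)
    (h : ReflTransGen (SpaceStep m k₀ k₁ yes R) (d, c') z) :
    ReflTransGen (SpaceStep m k₀ k₁ yes R) (some (q, v), c) z :=
  .head ⟨⟨q, v, o, rfl, hr, ho⟩, hc⟩ h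

/-- Induction on the statement, one rule per constructor. The hypothesis reserves two cells for the
bottom of a stack and one for each push still to come, so it passes on to the rest of the statement.
-/
theorem simulate_stmt (q : TM2.Stmt Γ Λ σ) (v : σ) (stk : ∀ k, List (Γ k))
    (hR : ∀ k, (stk k).length + 2 + pushes q < R) :
    ReflTransGen (SpaceStep m k₀ k₁ yes R) (some (q, v), extend k₀ stk)
      (some (resume m (TM2.stepAux q v stk).l, (TM2.stepAux q v stk).var),
        extend k₀ (TM2.stepAux q v stk).stk) := by
  have hc : ∀ k, (extend k₀ stk k).length < R := fun k => by
    have := hR k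
    have := length_extend_le (k₀ := k₀) (stk := stk) k
    omega
  -- Every rule carries an operation. Those for `load`, `branch` and `goto` harmlessly test the top
  -- of `k₀`, which exists because simulated stacks are never empty.
  obtain ⟨l₀, hl₀⟩ := extend_eq_cons (k₀ := k₀) (stk := stk) k₀
  induction q generalizing v stk l₀ with
  | push k f q ih =>
    have hR' : ∀ j, (Function.update stk k (f v :: stk k) j).length + 2 + pushes q < R := by
      intro j
      have := hR j
      rw [pushes] at this
      by_cases hj : j = k
      · subst hj
        rw [Function.update_self, List.length_cons]
        omega
      · rw [Function.update_of_ne hj]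
        omega
    obtain ⟨l, hl⟩ := extend_eq_cons (k₀ := k₀) (stk := Function.update stk k (f v :: stk k)) k₀
    refine head_of_rule (.push k f q v) ?_ hc (ih v _ hR' (fun j => ?_) l hl)
    · rw [extend_push]
      exact .push ..
    · have := hR' j
      have := length_extend_le (k₀ := k₀) (stk := Function.update stk k (f v :: stk k)) j
      omega
  | peek k f q ih =>
    obtain ⟨l, hl⟩ := extend_eq_cons (k₀ := k₀) (stk := stk) k
    exact head_of_rule (.peek k f q v _) (.keep _ _ _ l hl) hc (ih _ _ hR hc l₀ hl₀)
  | pop k f q ih =>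
    obtain ⟨l, hl⟩ := extend_eq_cons (k₀ := k₀) (stk := stk) k
    rw [TM2.stepAux]
    cases hs : stk k with
    | nil =>
      rw [hs] at hl
      have h2 : Function.update stk k [].tail = stk := by
        rw [List.tail_nil, ← hs, Function.update_eq_self]
      rw [h2]
      exact head_of_rule (.pop_none k f q v) (.keep _ _ _ l hl) hc
        (ih _ _ hR hc l₀ hl₀)
    | cons x t =>
      rw [hs, List.head?_cons] at hl
      have h2 := extend_pop hl
      rw [hs] at h2
      have hR' : ∀ j, (Function.update stk k (x :: t).tail j).length + 2 + pushes q < R := by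
        intro j
        have := hR j
        rw [pushes] at this
        by_cases hj : j = k
        · subst hj
          rw [hs, List.length_cons] at this
          rw [Function.update_self, List.tail_cons]
          omega
        · rw [Function.update_of_ne hj]
          omega
      obtain ⟨l', hl'⟩ := extend_eq_cons (k₀ := k₀) (stk := Function.update stk k (x :: t).tail) k₀
      refine head_of_rule (.pop_some k f q v x) (.pop _ _ _ l hl) hc ?_
      rw [← h2]
      refine ih _ _ hR' (fun j => ?_) l' hl'
      have := hR' j
      have := length_extend_le (k₀ := k₀) (stk := Function.update stk k (x :: t).tail) j
      omega
  | load f q ih =>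
    exact head_of_rule (.load f q v _) (.keep _ _ _ l₀ hl₀) hc (ih _ _ hR hc l₀ hl₀)
  | branch f q q' ih ih' =>
    refine head_of_rule (.branch f q q' v _) (.keep _ _ _ l₀ hl₀) hc ?_
    rw [TM2.stepAux]
    cases f v
    · exact ih' _ _ (fun k => by have := hR k; rw [pushes] at this; omega) hc l₀ hl₀
    · exact ih _ _ (fun k => by have := hR k; rw [pushes] at this; omega) hc l₀ hl₀
  | goto f =>
    exact head_of_rule (.goto f v _) (.keep _ _ _ l₀ hl₀) hc .refl
  | halt => exact .refl

theorem simulate {init c : TM2.Cfg Γ Λ σ} (h : StateTransition.Reaches (TM2.step m) init c)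
    (hR : ∀ c, StateTransition.Reaches (TM2.step m) init c →
      ∀ l k, (c.stk k).length + 2 + pushes (m l) < R) :
    ReflTransGen (SpaceStep m k₀ k₁ yes R) (some (resume m init.l, init.var), extend k₀ init.stk)
      (some (resume m c.l, c.var), extend k₀ c.stk) := by
  induction h with
  | refl => exact .refl
  | tail h1 h2 ih =>
    rename_i b c
    obtain ⟨_ | l, v, stk⟩ := b
    · simp at h2
    · simp only [TM2.step, Option.mem_def, Option.some.injEq] at h2
      subst h2
      exact ih.trans (simulate_stmt (m l) v stk (hR _ h1 l))

theorem simulate_accept {init : TM2.Cfg Γ Λ σ} {v : σ}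
    (h : StateTransition.Reaches (TM2.step m) init ⟨none, v, stk⟩)
    (hR : ∀ c, StateTransition.Reaches (TM2.step m) init c →
      ∀ l k, (c.stk k).length + 2 + pushes (m l) < R) (l : Λ)
    (hyes : (stk k₁).head? = some yes) :
    ∃ c, ReflTransGen (SpaceStep m k₀ k₁ yes R)
      (some (resume m init.l, init.var), extend k₀ init.stk) (none, c) := by
  obtain ⟨t, ht⟩ := extend_eq_cons (k₀ := k₀) (stk := stk) k₁
  rw [hyes] at ht
  refine ⟨extend k₀ stk, (simulate h hR).tail ⟨⟨_, _, _, rfl, .halt v, .keep _ _ _ t ht⟩, ?_⟩⟩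
  intro k
  have := hR _ h l k
  have := length_extend_le (k₀ := k₀) (stk := stk) k
  simp only at *
  omega

/-! ### The list of rules -/

/-- The list of the rules of the simulation of a machine. -/
noncomputable def ruleList [Finite K] [∀ k, Finite (Γ k)] [Finite Λ] [Finite σ]
    (m : Λ → TM2.Stmt Γ Λ σ) (k₀ k₁ : K) (yes : Γ k₁) :
    List (Control m × Control m × Op fun k => Option (Γ k)) :=
  (Set.toFinite {r | ∃ q v, r.1.val = some (q, v) ∧
    SimRule m k₀ k₁ yes q v r.2.1.val r.2.2}).toFinset.toList

variable [Finite K] [∀ k, Finite (Γ k)] [Finite Λ] [Finite σ]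

theorem ruleStep_iff {x y : Control m × ∀ k, List (Option (Γ k))} :
    RuleStep (ruleList m k₀ k₁ yes) x y ↔
      SimStep m k₀ k₁ yes (x.1.val, x.2) (y.1.val, y.2) := by
  simp only [RuleStep, ruleList, Finset.mem_toList, Set.Finite.mem_toFinset, Set.mem_ofPred_eq,
    SimStep]
  constructor
  · rintro ⟨o, ⟨q, v, h1, h2⟩, h3⟩
    exact ⟨q, v, o, h1, h2, h3⟩
  · rintro ⟨q, v, o, h1, h2, h3⟩
    exact ⟨o, ⟨q, v, h1, h2⟩, h3⟩


/-- Transfers a path over arbitrary statements to the finite type `Control m`, over which the domain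
is built. -/
theorem lift_spaceSteps {x : Control m × ∀ k, List (Option (Γ k))} {y}
    (h : ReflTransGen (SpaceStep m k₀ k₁ yes R) (x.1.val, x.2) y) :
    ∃ d : Control m, d.val = y.1 ∧
      ReflTransGen (fun x y => RuleStep (ruleList m k₀ k₁ yes) x y ∧ ∀ k, (x.2 k).length < R)
        x (d, y.2) := by
  induction h with
  | refl => exact ⟨x.1, rfl, .refl⟩
  | tail h1 h2 ih =>
    obtain ⟨d, hd, ih⟩ := ih
    obtain ⟨⟨q, v, o, hq, hr, ho⟩, hc⟩ := h2
    have hq' : ∃ l, q ∈ TM2.stmts₁ (m l) := by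
      rw [hq] at hd
      cases d with
      | none => simp [Control.val] at hd
      | some d =>
        simp only [Control.val, Option.map_some, Option.some.injEq, Prod.mk.injEq] at hd
        exact hd.1 ▸ d.1.2
    obtain ⟨d', hd'⟩ := Control.exists_val hr hq'
    refine ⟨d', hd', ih.tail ⟨ruleStep_iff.2 ⟨q, v, o, ?_, ?_, ho⟩, hc⟩⟩
    · rw [hd, hq]
    · rw [hd']
      exact hr

theorem sound_steps {x y : Control m × ∀ k, List (Option (Γ k))}
    (h : ReflTransGen (RuleStep (ruleList m k₀ k₁ yes)) x y) :
    ReflTransGen (SimStep m k₀ k₁ yes) (x.1.val, x.2) (y.1.val, y.2) :=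
  h.lift (fun x : Control m × ∀ k, List (Option (Γ k)) => (x.1.val, x.2)) fun _ _ =>
    ruleStep_iff.1

end TM2Planning

/-! ## Problems with a single possible goal -/

namespace HAGL

variable {F : Type} [DecidableEq F]

/-- The problem in which `G` is the only goal that is compatible with what the robot knows. -/
def singleGoal (D : PlanDomain F) (I G : Finset F) : HAGL F where
  robotDomain := D
  robotInit := I
  humanGoal := G
  humanDomain := ⟨[]⟩
  humanInit := G
  humanPlan := []
  oracle := fun f => decide (f ∈ G)
  exists_goal := ⟨G, ⟨G, rfl, subset_rfl⟩, subset_rfl, fun f => by simp⟩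

/-- A compatible goal lies between `G` and `G`. A solving procedure that returns a plan thus
exhibits one for `G`; conversely, a plan can be returned without any query. -/
theorem planWithQueries_singleGoal {D : PlanDomain F} {I G : Finset F} :
    (singleGoal D I G).PlanWithQueries 0 ↔ ∃ π, D.Achieves I π G := by
  constructor
  · rintro ⟨σ, hσ, ⟨π, hπ⟩, -⟩
    have h := hσ G ⟨⟨G, rfl, subset_rfl⟩, subset_rfl⟩
    change σ.run (fun f => decide (f ∈ G)) = some π at hπ
    rw [hπ] at h
    exact ⟨π, h⟩
  · rintro ⟨π, s, hs, hG⟩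
    refine ⟨.finish (some π), ?_, ⟨π, rfl⟩, le_rfl⟩
    rintro G' ⟨⟨s', hs', hG'⟩, -⟩
    obtain rfl : G = s' := Option.some.inj hs'
    exact ⟨s, hs, hG'.trans hG⟩

end HAGL

namespace HAGLInstance

open Computability

theorem encode_singleGoal {n : ℕ} {D : PlanDomain (Fin n)} {I G : Finset (Fin n)} :
    encode ⟨n, HAGL.singleGoal D I G, 0⟩ =
      encodeSet I ++ [Γ'.comma] ++ encodeSet G ++ [Γ'.comma] ++ encodeSet G ++ [Γ'.comma] ++
        encodeSet G ++ [Γ'.comma] ++ encodeActions D.actions ++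
        [Γ'.comma, Γ'.comma, Γ'.comma] := by
  have h1 : encodeSet (Finset.univ.filter fun f => (HAGL.singleGoal D I G).oracle f = true) =
      encodeSet G := by
    congr 1
    ext
    simp [HAGL.singleGoal]
  have h2 : encodeNat 0 = [] := rfl
  rw [encode, h1]
  simp only [HAGL.singleGoal, h2, encodeActions, List.flatMap_nil, List.map_nil,
    List.append_nil, List.append_assoc, List.cons_append, List.nil_append]

end HAGLInstance

namespace TM2Planning

open Computability StackPlanning StackProgram Turing Relation

/-! ## The strings of the reduction -/

variable {K : Type} [DecidableEq K] {Γ : K → Type} {Q : Type} {k₀ : K}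

/-- The lowest block of the initial configuration. -/
def lowestBlock : BlockFluent (fun k => Option (Γ k)) → Prop
  | .inl _ => False
  | .inr a => a.2 = none

/-- The second lowest block of the initial configuration. -/
def secondBlock (k₀ : K) : BlockFluent (fun k => Option (Γ k)) → Prop
  | .inl k => k ≠ k₀
  | .inr a => a.1 = k₀ ∧ a.2 = none

/-- The block of an input symbol. -/
def inputBlock (x : Γ k₀) (b : BlockFluent (fun k => Option (Γ k))) : Prop :=
  b = .inr ⟨k₀, some x⟩

/-- The block behind the input. -/
def topBlock (k₀ : K) (b : BlockFluent (fun k => Option (Γ k))) : Prop := b = .inl k₀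

theorem flatMap_range_eq {X Y : Type} {l : List X} {f : X → List Y} {g : ℕ → List Y}
    (h : ∀ i (hi : i < l.length), g i = f l[i]) :
    (List.range l.length).flatMap g = l.flatMap f := by
  rw [List.flatMap, List.flatMap]
  congr 1
  refine List.ext_getElem (by simp) fun i h1 h2 => ?_
  simp only [List.length_map, List.length_range] at h1
  simp [h i h1]

/-! ### The initial configuration, block by block -/

section Initial

variable (q : Q) (u : List (Γ k₀))

theorem extend_onlyStack_self :
    extend k₀ (onlyStack k₀ u) k₀ = u.map some ++ [none, none] := by
  simp [extend, onlyStack, base]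

theorem extend_onlyStack_of_ne {k : K} (hk : k ≠ k₀) :
    extend k₀ (onlyStack k₀ u) k = [none] := by
  simp [extend, onlyStack, base, hk]

theorem initial_lowest (b) :
    State q (extend k₀ (onlyStack k₀ u)) (.inr (0, b)) ↔ lowestBlock b := by
  rcases b with k | ⟨k, a⟩ <;> by_cases hk : k = k₀
  · subst hk
    simp [State, extend_onlyStack_self, lowestBlock]
  · simp [State, extend_onlyStack_of_ne u hk, lowestBlock]
  · subst hk
    simp [State, extend_onlyStack_self, lowestBlock, eq_comm]
  · simp [State, extend_onlyStack_of_ne u hk, lowestBlock, eq_comm]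

theorem initial_second (b) :
    State q (extend k₀ (onlyStack k₀ u)) (.inr (1, b)) ↔ secondBlock k₀ b := by
  rcases b with k | ⟨k, a⟩ <;> by_cases hk : k = k₀
  · subst hk
    simp [State, extend_onlyStack_self, secondBlock]
  · simp [State, extend_onlyStack_of_ne u hk, secondBlock, hk]
  · subst hk
    simp [State, extend_onlyStack_self, secondBlock, eq_comm]
  · simp [State, extend_onlyStack_of_ne u hk, secondBlock, hk]

theorem initial_input (i : ℕ) (hi : i < u.reverse.length) (b) :
    State q (extend k₀ (onlyStack k₀ u)) (.inr (2 + i, b)) ↔ inputBlock u.reverse[i] b := by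
  rw [Nat.add_comm 2 i]
  have hi' : i ≠ u.length := by
    rw [List.length_reverse] at hi
    omega
  rcases b with k | ⟨k, a⟩ <;> by_cases hk : k = k₀
  · subst hk
    simpa [State, extend_onlyStack_self, inputBlock] using hi'
  · simp [State, extend_onlyStack_of_ne u hk, inputBlock]
  · subst hk
    have h1 : u[u.length - 1 - i]? = some u.reverse[i] := by
      rw [List.getElem_reverse]
      exact List.getElem?_eq_getElem _
    rw [List.length_reverse] at hi
    simp [State, extend_onlyStack_self, inputBlock, hi, eq_comm]
  · simp [State, extend_onlyStack_of_ne u hk, inputBlock, hk]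

theorem initial_top (b) :
    State q (extend k₀ (onlyStack k₀ u)) (.inr (2 + u.length, b)) ↔ topBlock k₀ b := by
  rw [Nat.add_comm 2]
  rcases b with k | ⟨k, a⟩ <;> by_cases hk : k = k₀
  · subst hk
    simp [State, extend_onlyStack_self, topBlock]
  · simp [State, extend_onlyStack_of_ne u hk, topBlock, hk]
  · subst hk
    simp [State, extend_onlyStack_self, topBlock]
  · simp [State, extend_onlyStack_of_ne u hk, topBlock]

theorem initial_above (i : ℕ) (b) :
    ¬ State q (extend k₀ (onlyStack k₀ u)) (.inr (2 + u.length + 1 + i, b)) := by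
  rw [show 2 + u.length + 1 + i = u.length + i + 1 + 2 by omega]
  rcases b with k | ⟨k, a⟩ <;> by_cases hk : k = k₀
  · subst hk
    simp [State, extend_onlyStack_self]
    omega
  · simp [State, extend_onlyStack_of_ne u hk]
  · subst hk
    simp [State, extend_onlyStack_self]
    rw [List.getElem?_eq_none (by simp; omega)]
    simp
  · simp [State, extend_onlyStack_of_ne u hk]

theorem encodeSet_initial (Y : Layout Q fun k => Option (Γ k)) {S e : ℕ}
    (hS : S = 2 + u.length + 1 + e) :
    HAGLInstance.encodeSet (Y.toSet S (State q (extend k₀ (onlyStack k₀ u)))) =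
      Y.globalStr (· = q) ++ (Y.blockStr lowestBlock ++ Y.blockStr (secondBlock k₀)) ++
        (u.reverse.flatMap (fun x => Y.blockStr (inputBlock x)) ++
          (Y.blockStr (topBlock k₀) ++ Emitter.zeros (Y.width * e))) := by
  subst hS
  rw [Y.encodeSet_toSet, List.append_assoc]
  congr 1
  rw [List.range_add, List.range_add, List.range_add]
  simp only [List.flatMap_append, List.flatMap_map, List.append_assoc]
  rw [show List.range 2 = [0, 1] from rfl, show List.range 1 = [0] from rfl]
  simp only [List.flatMap_cons, List.flatMap_nil, List.append_nil, List.append_assoc, add_zero]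
  simp only [initial_lowest, initial_second, initial_top]
  congr 3
  · rw [← List.length_reverse]
    refine flatMap_range_eq fun i hi => ?_
    simp only [initial_input q u i hi]
  · congr 1
    exact Y.flatMap_blockStr_false (f := fun i => 2 + u.length + 1 + i)
      (p := fun i b => State q (extend k₀ (onlyStack k₀ u)) (.inr (i, b))) e
      fun i _ b => initial_above q u i b

end Initial

end TM2Planning

namespace TM2Planning

open Computability StackPlanning StackProgram Turing Relation

/-! ## The reduction -/

/-- Bounds of this special form are the ones that `Emitter.power` can compute. -/
theorem exists_lt_pow (p : Polynomial ℕ) : ∃ c d : ℕ, ∀ n : ℕ, p.eval n < (n + c) ^ d := by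
  induction p using Polynomial.induction_on' with
  | add p q hp hq =>
    obtain ⟨c, d, hp⟩ := hp
    obtain ⟨c', d', hq⟩ := hq
    -- The base is at least 2, so the additional factor absorbs the sum of the two bounds.
    refine ⟨c + c' + 2, d + d' + 1, fun n => ?_⟩
    have h1 : (n + c) ^ d ≤ (n + (c + c' + 2)) ^ (d + d') :=
      (Nat.pow_le_pow_left (by omega) d).trans (Nat.pow_le_pow_right (by omega) (by omega))
    have h2 : (n + c') ^ d' ≤ (n + (c + c' + 2)) ^ (d + d') :=
      (Nat.pow_le_pow_left (by omega) d').trans (Nat.pow_le_pow_right (by omega) (by omega))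
    have h3 : (n + (c + c' + 2)) ^ (d + d') * 2 ≤ (n + (c + c' + 2)) ^ (d + d' + 1) := by
      rw [pow_succ]
      exact Nat.mul_le_mul_left _ (by omega)
    have h4 := hp n
    have h5 := hq n
    rw [Polynomial.eval_add]
    omega
  | monomial k a =>
    refine ⟨a + 1, k + 1, fun n => ?_⟩
    rw [Polynomial.eval_monomial, pow_succ, mul_comm]
    calc n ^ k * a ≤ (n + (a + 1)) ^ k * a :=
          Nat.mul_le_mul_right _ (Nat.pow_le_pow_left (by omega) k)
      _ < (n + (a + 1)) ^ k * (n + (a + 1)) :=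
          Nat.mul_lt_mul_of_pos_left (by omega) (Nat.pow_pos (by omega))

/-! ### Determinism of computations -/

theorem reaches_of_iterate {X : Type} {f : X → Option X} {a b : X} {n : ℕ}
    (h : (flip bind f)^[n] (some a) = some b) : StateTransition.Reaches f a b := by
  induction n generalizing b with
  | zero =>
    obtain rfl := Option.some.inj h
    exact .refl
  | succ n ih =>
    rw [Function.iterate_succ_apply'] at h
    obtain ⟨c, hc, hcb⟩ := Option.bind_eq_some_iff.1 h
    exact (ih hc).tail hcb

theorem eq_of_reaches_of_halted {X : Type} {f : X → Option X} {a b c : X}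
    (hb : StateTransition.Reaches f a b) (hc : StateTransition.Reaches f a c)
    (hb' : f b = none) (hc' : f c = none) : b = c := by
  have key : ∀ {x y}, f x = none → StateTransition.Reaches f x y → x = y := by
    intro x y hx h
    rcases ReflTransGen.cases_head h with h | ⟨z, hz, -⟩
    · exact h
    · rw [hx] at hz
      cases hz
  rcases StateTransition.reaches_total hb hc with h | h
  · exact key hb' h
  · exact (key hc' h).symm

theorem initList_eq (M : FinTM2) (u : List (M.Γ M.k₀)) :
    initList M u = ⟨some M.main, M.initialState, onlyStack M.k₀ u⟩ := by
  rw [initList]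
  congr 1
  funext j
  exact (onlyStack_eq M.k₀ u j).symm

theorem haltList_eq (M : FinTM2) (u : List (M.Γ M.k₁)) :
    haltList M u = ⟨none, M.initialState, onlyStack M.k₁ u⟩ := by
  rw [haltList]
  congr 1
  funext j
  exact (onlyStack_eq M.k₁ u j).symm

/-- The control state in which the simulation starts. -/
def start (M : FinTM2) : Control M.m :=
  some (⟨M.m M.main, M.main, TM2.stmts₁_self⟩, M.initialState)

/-- A plan of the simulating domain exists iff the machine accepts. -/
theorem exists_plan_iff (M : FinTM2) [Finite M.K] [∀ k, Finite (M.Γ k)] [Finite M.Λ] [Finite M.σ]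
    (Y : Layout (Control M.m) fun k => Option (M.Γ k)) (yes : M.Γ M.k₁) {R : ℕ}
    {u : List (M.Γ M.k₀)} {out : List (M.Γ M.k₁)}
    (hout : StateTransition.Reaches M.step (initList M u) (haltList M out))
    (hR : ∀ c : M.Cfg, StateTransition.Reaches M.step (initList M u) c →
      ∀ l k, (TM2.Cfg.stk c k).length + 2 + pushes (M.m l) < R) :
    (∃ π, (Y.domain (ruleList M.m M.k₀ M.k₁ yes) R).Achieves
      (Y.toSet (R + 1) (State (start M) (extend M.k₀ (onlyStack M.k₀ u)))) π
      (Y.toSet (R + 1) (· = .inl none))) ↔ out.head? = some yes := by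
  rw [initList_eq] at hout hR
  rw [haltList_eq] at hout
  constructor
  · rintro ⟨π, s, hs, hG⟩
    obtain ⟨x, rfl, hx⟩ := exec_sound π _ _ hs
    have hnone : none = x.1 := Y.of_toSet_subset_inl hG rfl
    have hinv : Invariant M.m M.k₀ M.k₁ yes ⟨some M.main, M.initialState, onlyStack M.k₀ u⟩
        ((start M).val, extend M.k₀ (onlyStack M.k₀ u)) :=
      -- Finishing the statement at `M.main` is the first step of the machine.
      ⟨_, rfl, ReflTransGen.single rfl⟩
    have h := hinv.steps (sound_steps hx)
    rw [← hnone] at h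
    obtain ⟨v, stk, hreach, hyes⟩ := h
    -- The halted configuration found through the plan must be the actual output configuration.
    have h1 := eq_of_reaches_of_halted hout hreach rfl rfl
    have h2 : onlyStack M.k₁ out = stk := congrArg TM2.Cfg.stk h1
    rw [← h2] at hyes
    simpa [onlyStack] using hyes
  · intro hyes
    obtain ⟨c, hc⟩ := simulate_accept (k₀ := M.k₀) (k₁ := M.k₁) (yes := yes) (R := R) hout hR
      M.main (by simpa [onlyStack] using hyes)
    obtain ⟨d, hd, hpath⟩ := lift_spaceSteps
      (x := (start M, extend M.k₀ (onlyStack M.k₀ u))) hc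
    obtain rfl : d = none := by simpa [Control.val] using hd
    obtain ⟨π, hπ⟩ := exec_complete (Y := Y) hpath
    exact ⟨π, _, hπ, Y.toSet_mono _ fun x hx => by rw [hx]; rfl⟩

open Emitter in
/-- The strings of which the output of the reduction is composed. -/
noncomputable def blueprint {α : Type} (M : FinTM2) [Finite M.K] [∀ k, Finite (M.Γ k)]
    [Finite M.Λ] [Finite M.σ] (φ : α → M.Γ M.k₀) (yes : M.Γ M.k₁)
    (Y : Layout (Control M.m) fun k => Option (M.Γ k)) (c d : ℕ) : Blueprint α where
  width := Y.width
  offset := c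
  degree := d
  goal := Y.globalStr (· = none)
  start := Y.globalStr (· = start M) ++ (Y.blockStr lowestBlock ++ Y.blockStr (secondBlock M.k₀))
  cell := fun x => Y.blockStr (inputBlock (φ x))
  length_cell := fun _ => Y.length_blockStr _
  mark := Y.blockStr (topBlock M.k₀)
  templates := (ruleList M.m M.k₀ M.k₁ yes).map Y.template

section Reduction

variable {α : Type} (M : FinTM2) [Finite M.K] [∀ k, Finite (M.Γ k)] [Finite M.Λ] [Finite M.σ]
  (φ : α → M.Γ M.k₀) (yes : M.Γ M.k₁) (Y : Layout (Control M.m) fun k => Option (M.Γ k)) (c d : ℕ)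

/-- The instance to which an input of the machine is mapped. -/
noncomputable def reduction (w : List α) : HAGLInstance where
  numFluents := Y.size (w.length + (w.length + c) ^ d + 2 + 1)
  problem := HAGL.singleGoal
    (Y.domain (ruleList M.m M.k₀ M.k₁ yes) (w.length + (w.length + c) ^ d + 2))
    (Y.toSet _ (State (start M) (extend M.k₀ (onlyStack M.k₀ (w.map φ)))))
    (Y.toSet _ (· = .inl none))
  bound := 0

/-- The block counts agree: two bottom blocks, one per input symbol, one for the marker of the input
stack, and `(n + c) ^ d` spare ones. -/
theorem encode_reduction (w : List α) :
    (reduction M φ yes Y c d w).encode = (blueprint M φ yes Y c d).output w := by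
  have hS : w.length + (w.length + c) ^ d + 2 + 1 =
      2 + (w.map φ).length + 1 + (w.length + c) ^ d := by
    rw [List.length_map]
    omega
  rw [reduction, HAGLInstance.encode_singleGoal, encodeSet_initial _ _ _ hS,
    Y.encodeSet_singleton, Y.encodeActions_domain, ← List.map_reverse, List.flatMap_map]
  rfl

end Reduction

end TM2Planning

open TM2Planning StackPlanning Turing in
theorem proposition1 : PSPACEHard HAGLInstance.encode HAGLInstance.IsYes := by
  classical
  intro α _ L hL
  obtain ⟨M, p, hfin, hspace⟩ := hL
  let _ := M.tm.kFin
  let _ := M.tm.ΛFin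
  let _ := M.tm.σFin
  let Y : Layout (Control M.tm.m) fun k => Option (M.tm.Γ k) :=
    { numGlobal := _, width := _, globalEquiv := Finite.equivFin _, blockEquiv := Finite.equivFin _ }
  let yes := M.outputAlphabet.symm true
  -- The constant leaves room for the symbols pushed in the middle of a statement, where `cfgSpace`
  -- gives no bound.
  obtain ⟨c, d, hcd⟩ := exists_lt_pow (p + .C (∑ l, pushes (M.tm.m l)))
  refine ⟨reduction M.tm M.inputAlphabet.invFun yes Y c d,
    (blueprint M.tm M.inputAlphabet.invFun yes Y c d).computableInPolyTime _ _
      (encode_reduction _ _ _ _ _ _), fun w => ?_⟩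
  have hout := reaches_of_iterate (M.outputsFun w).evals_in_steps
  have hplan := exists_plan_iff M.tm Y yes (R := w.length + (w.length + c) ^ d + 2) hout
    (fun b hb l k => by
      have h1 : (TM2.Cfg.stk b k).length ≤ cfgSpace M.tm b :=
        Finset.single_le_sum (f := fun k => (TM2.Cfg.stk b k).length) (fun _ _ => Nat.zero_le _)
          (Finset.mem_univ k)
      have h2 := hspace w b hb
      have h3 : pushes (M.tm.m l) ≤ ∑ l, pushes (M.tm.m l) :=
        Finset.single_le_sum (f := fun l => pushes (M.tm.m l)) (fun _ _ => Nat.zero_le _)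
          (Finset.mem_univ l)
      have h4 := hcd w.length
      rw [Polynomial.eval_add, Polynomial.eval_C] at h4
      omega)
  refine Iff.trans ?_ (HAGL.planWithQueries_singleGoal.trans hplan).symm
  -- The output is the single symbol for `decide (w ∈ L)`, and the bijection of output alphabets
  -- makes it equal to `yes` only for `true`.
  simp [Computability.encodeBool, yes]
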